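/- Let $\Sigma$ be a finite alphabet. Two words $u,v\in\Sigma^\omega$ have equal ends, $u\sim_e v$, if $u[n]=v[n]$ for all but finitely many $n$. An $\omega$-automaton with $m$ tapes is a finite non-deterministic automaton with Büchi, parity or Muller acceptance whose transitions are labelled by $m$-tuples of letters; it accepts a tuple of $m$ infinite words if it accepts their convolution. An $\omega$-automatic presentation $\mathfrak d$ of a relational structure $\mathfrak A$ with finitely many relations $R_1,\dots,R_r$ consists of $\omega$-automata $\mathcal A,\mathcal A_\approx,\mathcal A_1,\dots,\mathcal A_r$ and a surjection $f\colon L(\mathcal A)\to\mathrm{dom}(\mathfrak A)$ such that $\mathcal A_\approx$ recognises the relation $u\approx w :\Leftrightarrow f(u)=f(w)$ on $L(\mathcal A)$, each $L(\mathcal A_i)$ is a relation on $L(\mathcal A)$ of the arity of $R_i$, and $f$ induces an isomorphism from $(L(\mathcal A),L(\mathcal A_1),\dots,L(\mathcal A_r))/{\approx}$ onto $\mathfrak A$. For a first-order formula $\varphi(x,\vec z)$ in the language of $\mathfrak A$ and a tuple $\vec z$ of infinite words, let $\varphi(-,\vec z)$ be the set of words $x\in L(\mathcal A)$ such that all $z_i\in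 L(\mathcal A)$ and $\mathfrak A\models\varphi(f(x),f(\vec z))$. There is a computable function that assigns to the automata of $\mathfrak d$ and the formula $\varphi(x,\vec z)$ a number $C$ such that the following holds for every structure $\mathfrak A$ and naming function $f$ presented by these automata. (a) For all tuples $\vec z$ of infinite words the following are equivalent: (1) $\varphi(-,\vec z)$ is non-empty, and $\approx$ restricted to $\varphi(-,\vec z)$ has only countably many (finitely or countably infinitely many) classes; (2) there are words $x_1,\dots,x_C\in\varphi(-,\vec z)$, not necessarily distinct, such that every $x\in\varphi(-,\vec z)$ satisfies $x\approx y$ for some $y$ with $y\sim_e x_i$ for some $i$. (b) If $\varphi(-,\vec z)$ is non-empty and (2) fails, then $\varphi(-,\vec z)$ contains a set of cardinality $2^{\aleph_0}$ of pairwise non-$\approx$-equivalent words. (c) Consequently the countability quantifier is first-order definable in the structure $(L(\mathcal A),L(\mathcal A_1),\dots,L(\mathcal A_r),\approx,\sim_e)$: write $\varphi$ also for the formula obtained by reading equality as $\approx$, and let $\psi_C(\vec z)$ be $$\exists x_1\dots x_C\Big(\bigwedge_{i}\varphi(x_i,\vec z)\wedge\forall x\big(\varphi(x,\vec z)\rightarrow\exists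 y\,(x\approx y\wedge\bigvee_i y\sim_e x_i)\big)\Big).$$ For all tuples $\vec z$ in $L(\mathcal A)$, this structure satisfies $\psi_C(\vec z)$ iff (1) holds, and it satisfies $\exists w\,\varphi(w,\vec z)\rightarrow\psi_C(\vec z)$ iff $\approx$ restricted to $\varphi(-,\vec z)$ has at most countably many classes. -/

import Mathlib

open Cardinal

namespace OmegaAut

/-! ### Infinite words and omega-automata -/

/-- Infinite words over the finite alphabet `{0, …, k - 1}`. -/
abbrev Word (k : ℕ) : Type := ℕ → Fin k

/-- Two infinite words have equal ends if they agree at almost all positions. -/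
def EqualEnds {k : ℕ} (u v : Word k) : Prop := ∀ᶠ n in Filter.atTop, u n = v n

/-- Büchi, parity and Muller acceptance conditions for automata with states `{0, …, n - 1}`. -/
inductive Acceptance (n : ℕ) : Type
  | buchi (F : List (Fin n)) : Acceptance n
  | parity (p : Fin n → ℕ) : Acceptance n
  | muller (T : List (List (Fin n))) : Acceptance n

/-- The acceptance condition holds of the set `Q` of states that a run visits infinitely often:
Büchi: some accepting state is in `Q`; parity: the least priority of a state in `Q` is even;
Muller: `Q` is one of the sets in the table. -/
def Acceptance.Holds {n : ℕ} : Acceptance n → Set (Fin n) → Prop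
  | .buchi F, Q => ∃ q ∈ F, q ∈ Q
  | .parity p, Q => ∃ q ∈ Q, Even (p q) ∧ ∀ r ∈ Q, p q ≤ p r
  | .muller T, Q => ∃ S ∈ T, Q = {q | q ∈ S}

/-- A non-deterministic `m`-tape synchronous omega-automaton over the alphabet `{0, …, k - 1}`:
its transitions are labelled by `m`-tuples of letters. -/
structure Automaton (k m : ℕ) : Type where
  states : ℕ
  init : List (Fin states)
  trans : List (Fin states × (Fin m → Fin k) × Fin states)
  acc : Acceptance states

/-- The automaton accepts the convolution of the tuple `w` of infinite words. -/
def Automaton.Accepts {k m : ℕ} (B : Automaton k m) (w : Fin m → Word k) : Prop :=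
  ∃ ρ : ℕ → Fin B.states,
    ρ 0 ∈ B.init ∧
    (∀ i, (ρ i, (fun j => w j i), ρ (i + 1)) ∈ B.trans) ∧
    B.acc.Holds {q | ∃ᶠ i in Filter.atTop, ρ i = q}

/-! ### Omega-automatic presentations -/

/-- The syntactic part of an omega-automatic presentation: an alphabet, finitely many relation
symbols with their arities, and automata for the domain, the equivalence and the relations. -/
structure Presentation : Type where
  alphabet : ℕ
  numRel : ℕ
  arity : Fin numRel → ℕ
  domAut : Automaton alphabet 1
  eqvAut : Automaton alphabet 2
  relAut : (i : Fin numRel) → Automaton alphabet (arity i)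

namespace Presentation

variable (P : Presentation)

/-- The relational first-order language of the presented structure. -/
def lang : FirstOrder.Language.{0, 0} where
  Functions := fun _ => Empty
  Relations := fun n => {i : Fin P.numRel // P.arity i = n}

/-- The words accepted by the domain automaton. -/
def dom : Set (Word P.alphabet) := {w | P.domAut.Accepts ![w]}

/-- The relation on words recognised by the automaton for the equivalence. -/
def Approx (u v : Word P.alphabet) : Prop := P.eqvAut.Accepts ![u, v]

/-- The automata of `P`, with the naming function `f`, present the structure `A`: `f` is onto,
the equivalence automaton recognises `{(u, w) | f u = f w}`, and `f` induces an isomorphism from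
the quotient of the structure on words onto `A`. -/
structure Presents (A : Type*) [P.lang.Structure A] (f : P.dom → A) : Prop where
  surjective : Function.Surjective f
  approx_iff : ∀ u v : Word P.alphabet,
    P.Approx u v ↔ ∃ (hu : u ∈ P.dom) (hv : v ∈ P.dom), f ⟨u, hu⟩ = f ⟨v, hv⟩
  rel_iff : ∀ (i : Fin P.numRel) (w : Fin (P.arity i) → Word P.alphabet),
    (P.relAut i).Accepts w ↔
      ∃ hw : ∀ j, w j ∈ P.dom,
        FirstOrder.Language.Structure.RelMap (L := P.lang) (⟨i, rfl⟩ : P.lang.Relations (P.arity i))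
          (fun j => f ⟨w j, hw j⟩)

/-- The set `φ(-, z)` of words `x` such that `x` and all `z i` name elements of `A` and
`φ(x, z)` holds in `A`. The variable `0` of `φ` is `x`, the variable `i + 1` is `z i`. -/
def solutions {A : Type*} [P.lang.Structure A] (f : P.dom → A) {m : ℕ}
    (φ : P.lang.Formula (Fin (m + 1))) (z : Fin m → Word P.alphabet) :
    Set (Word P.alphabet) :=
  {x | ∃ (hx : x ∈ P.dom) (hz : ∀ i, z i ∈ P.dom),
    φ.Realize (Fin.cons (f ⟨x, hx⟩) (fun i => f ⟨z i, hz i⟩) : Fin (m + 1) → A)}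

/-- The equivalence classes of the relation `Approx` restricted to the set `S`. -/
def classes (S : Set (Word P.alphabet)) : Set (Set (Word P.alphabet)) :=
  {E | ∃ x ∈ S, E = {y ∈ S | P.Approx x y}}

/-- There are `C` words in `S` such that every word in `S` is equivalent to a word with
equal ends to one of them. -/
def CoveredByEnds (S : Set (Word P.alphabet)) (C : ℕ) : Prop :=
  ∃ x : Fin C → Word P.alphabet, (∀ i, x i ∈ S) ∧
    ∀ u ∈ S, ∃ y, P.Approx u y ∧ ∃ i, EqualEnds y (x i)

/-! ### The structure on words expanded by the equivalence and the equal-ends relation -/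

/-- Two additional binary relation symbols, for the equivalence and for equal ends. -/
inductive EndsRel : ℕ → Type
  | approx : EndsRel 2
  | eqEnds : EndsRel 2

/-- The language of the presented structure expanded by the two symbols. -/
def endsLang : FirstOrder.Language.{0, 0} where
  Functions := fun _ => Empty
  Relations := fun n => P.lang.Relations n ⊕ EndsRel n

/-- The structure whose elements are the words in the domain, whose relations are those
recognised by the given automata, together with the equivalence and equal ends. -/
instance endsStructure : P.endsLang.Structure P.dom where
  funMap := fun g => nomatch g
  RelMap := fun {_} R => match R with
    | .inl R => fun w => (P.relAut R.1).Accepts (fun j => (w (Fin.cast R.2 j)).1)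
    | .inr .approx => fun w => P.Approx (w 0).1 (w 1).1
    | .inr .eqEnds => fun w => EqualEnds (w 0).1 (w 1).1

/-- Terms of the expanded language are variables, like those of the original one. -/
def liftTerm {α : Type} : P.lang.Term α → P.endsLang.Term α
  | .var a => .var a
  | .func g _ => nomatch g

/-- A first-order formula about the presented structure, read in the structure on words:
equality of elements becomes equivalence of words. -/
def lift {α : Type} : {n : ℕ} → P.lang.BoundedFormula α n → P.endsLang.BoundedFormula α n
  | _, .falsum => .falsum
  | _, .equal s t =>
      FirstOrder.Language.BoundedFormula.rel (L := P.endsLang) (l := 2) (Sum.inr EndsRel.approx)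
        ![P.liftTerm s, P.liftTerm t]
  | n, .rel (l := l) R ts =>
      FirstOrder.Language.BoundedFormula.rel (L := P.endsLang) (n := n) (l := l) (Sum.inl R)
        (fun j => P.liftTerm (ts j))
  | _, .imp φ ψ => .imp (lift φ) (lift ψ)
  | _, .all φ => .all (lift φ)

/-- The formula `φ(t, z)` of the expanded language, for a variable `t` and variables `z i`. -/
def liftAt {m : ℕ} {β : Type} (φ : P.lang.Formula (Fin (m + 1))) (t : β) (z : Fin m → β) :
    P.endsLang.Formula β :=
  FirstOrder.Language.Formula.relabel (Fin.cons t z : Fin (m + 1) → β)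
    (P.lift φ : P.endsLang.Formula (Fin (m + 1)))

/-- The atomic formula stating that the given relation holds of the variables `s` and `t`. -/
def atom {β : Type} (R : EndsRel 2) (s t : β) : P.endsLang.Formula β :=
  FirstOrder.Language.Relations.formula₂ (L := P.endsLang) (Sum.inr R : P.endsLang.Relations 2)
    (FirstOrder.Language.Term.var s) (FirstOrder.Language.Term.var t)

/-- The first-order formula, with free variables `z`,
`∃ x₁ … x_C (⋀ᵢ φ(xᵢ, z) ∧ ∀ x (φ(x, z) → ∃ y (x ≈ y ∧ ⋁ᵢ y ∼ₑ xᵢ)))`. -/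
noncomputable def coverFormula {m : ℕ} (φ : P.lang.Formula (Fin (m + 1))) (C : ℕ) :
    P.endsLang.Formula (Fin m) :=
  FirstOrder.Language.Formula.iExs (Fin C)
    ((FirstOrder.Language.BoundedFormula.iInf fun i : Fin C =>
        P.liftAt φ (Sum.inr i : Fin m ⊕ Fin C) Sum.inl) ⊓
      FirstOrder.Language.Formula.iAlls Unit
        ((P.liftAt φ (Sum.inr () : (Fin m ⊕ Fin C) ⊕ Unit) (fun i => Sum.inl (Sum.inl i))).imp
          (FirstOrder.Language.Formula.iExs Unit
            (P.atom .approx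
                (Sum.inl (Sum.inr ()) : ((Fin m ⊕ Fin C) ⊕ Unit) ⊕ Unit) (Sum.inr ()) ⊓
              FirstOrder.Language.BoundedFormula.iSup fun i : Fin C =>
                P.atom .eqEnds
                  (Sum.inr () : ((Fin m ⊕ Fin C) ⊕ Unit) ⊕ Unit)
                  (Sum.inl (Sum.inl (Sum.inr i)))))))

/-- The first-order formula `∃ w φ(w, z) → coverFormula`, which eliminates the quantifier
“there are at most countably many”. -/
noncomputable def countableFormula {m : ℕ} (φ : P.lang.Formula (Fin (m + 1))) (C : ℕ) :
    P.endsLang.Formula (Fin m) :=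
  (FirstOrder.Language.Formula.iExs Unit
    (P.liftAt φ (Sum.inr () : Fin m ⊕ Unit) Sum.inl)).imp (P.coverFormula φ C)

end Presentation

/-! ### Finite descriptions, as inputs of algorithms -/

/-- Descriptions of acceptance conditions: a tag and a list of lists. -/
abbrev AcceptanceData : Type := ℕ × List (List ℕ)

def Acceptance.data {n : ℕ} : Acceptance n → AcceptanceData
  | .buchi F => (0, [F.map Fin.val])
  | .parity p => (1, [List.ofFn p])
  | .muller T => (2, T.map (List.map Fin.val))

/-- Descriptions of automata: number of states, initial states, transitions, acceptance. -/
abbrev AutomatonData : Type := ℕ × List ℕ × List (ℕ × List ℕ × ℕ) × AcceptanceData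

def Automaton.data {k m : ℕ} (B : Automaton k m) : AutomatonData :=
  (B.states, B.init.map Fin.val,
    B.trans.map (fun t => (t.1.val, List.ofFn (fun j => (t.2.1 j).val), t.2.2.val)),
    B.acc.data)

/-- Descriptions of presentations: size of the alphabet, the automata for the domain and the
equivalence, and the list of the arities and automata of the relation symbols. -/
abbrev PresentationData : Type :=
  ℕ × AutomatonData × AutomatonData × List (ℕ × AutomatonData)

def Presentation.data (P : Presentation) : PresentationData :=
  (P.alphabet, P.domAut.data, P.eqvAut.data,
    List.ofFn (fun i => (P.arity i, (P.relAut i).data)))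

/-- The code of a variable: free variables are even, bound variables odd. -/
def Presentation.termCode (P : Presentation) {k n : ℕ} : P.lang.Term (Fin k ⊕ Fin n) → ℕ
  | .var (.inl i) => 2 * i.val
  | .var (.inr i) => 2 * i.val + 1
  | .func g _ => nomatch g

/-- A formula written in prefix notation, as a list of natural numbers. -/
def Presentation.formulaCode (P : Presentation) {k : ℕ} :
    {n : ℕ} → P.lang.BoundedFormula (Fin k) n → List ℕ
  | _, .falsum => [0]
  | _, .equal s t => [1, P.termCode s, P.termCode t]
  | _, .rel R ts => 2 :: R.1.val :: List.ofFn (fun j => P.termCode (ts j))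
  | _, .imp φ ψ => 3 :: (P.formulaCode φ ++ P.formulaCode ψ)
  | _, .all φ => 4 :: P.formulaCode φ

end OmegaAut

/-! Cut an infinite word into finite factors. A relation given by an automaton or a first-order
formula depends only on the sequence of types of the factors, where the types form a finite set of
computable size (`Recognizes`, `RecognizesFormula`). For an automaton the type records which runs
the factor allows (`Automaton.recognizes_profile`); a quantifier passes to sets of types
(`recognizesFormula_all`). No automaton is ever complemented, and the types need not carry a
product.

Suppose that φ(-, z) is non-empty and not covered by C ends. A greedy choice yields C solutions,
none of which is equivalent to a word with the end of an earlier one (`exists_separated`). Ramsey's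
theorem yields positions g 0 < g 1 < … between which all these solutions, and all pairs of them,
have constant types. As C exceeds the number of possible types, two solutions x and y, with x the
earlier one, have the same solution type, and (x, x) has the same type as (y, y).

A word that starts like y and then follows y on the intervals in a set D and x on the others is
again a solution. Take two such splices, along D ⊆ E, with E \ D infinite and without consecutive
elements. Up to factors of equal type, their convolution factors into types p b a b a …, so whether
they are equivalent does not depend on D and E (`Mixed.rel_iff`). If they were, then the splice
along ∅ would be equivalent to that along the even numbers, and this to that along ℕ, which is y.
But the splice along ∅ has the end of x, a contradiction (`not_rel_mix`). A chain of continuum many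
sets of even numbers with infinite differences now gives continuum many inequivalent solutions
(`exists_continuum_pairwise_not_rel`).

Conversely only countably many words share a given end, so finitely many ends cover only countably
many classes. Definability is then a matter of evaluating the formulas. -/

namespace OmegaAut

/-! ### Segments of infinite words and factorisations -/

/-- The finite word read by `α` on the positions `a, …, b - 1`. -/
def seg {X : Type*} (α : ℕ → X) (a b : ℕ) : List X := (List.range (b - a)).map fun t => α (a + t)

@[simp] lemma seg_length {X : Type*} (α : ℕ → X) (a b : ℕ) : (seg α a b).length = b - a := by
  simp [seg]

@[simp] lemma seg_getElem {X : Type*} (α : ℕ → X) (a b t : ℕ) (h : t < (seg α a b).length) :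
    (seg α a b)[t] = α (a + t) := by
  simp [seg]

lemma seg_map {X Y : Type*} (g : X → Y) (α : ℕ → X) (a b : ℕ) :
    (seg α a b).map g = seg (fun n => g (α n)) a b := by
  simp [seg]

lemma seg_congr {X : Type*} {α β : ℕ → X} {a b : ℕ} (h : ∀ n, a ≤ n → n < b → α n = β n) :
    seg α a b = seg β a b := by
  unfold seg
  refine List.map_congr_left fun t ht => h _ (by omega) ?_
  have := List.mem_range.1 ht
  omega

/-- The cut positions of a factorisation of an infinite word into non-empty finite words. -/
structure IsCut (c : ℕ → ℕ) : Prop where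
  zero : c 0 = 0
  strictMono : StrictMono c

/-- The index of the interval of the partition given by `c` which contains `n`. -/
def blockIndex (c : ℕ → ℕ) (n : ℕ) : ℕ := Nat.findGreatest (fun i => c i ≤ n) n

lemma blockIndex_le {c : ℕ → ℕ} {n : ℕ} (h : c 0 ≤ n) : c (blockIndex c n) ≤ n :=
  Nat.findGreatest_spec (P := fun i => c i ≤ n) (Nat.zero_le n) h

lemma lt_blockIndex_succ {c : ℕ → ℕ} (hc : StrictMono c) (n : ℕ) :
    n < c (blockIndex c n + 1) := by
  by_contra! h
  have h1 : blockIndex c n + 1 ≤ n := (hc.id_le _).trans h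
  have := Nat.le_findGreatest (P := fun i => c i ≤ n) h1 h
  unfold blockIndex at this
  omega

lemma blockIndex_eq {c : ℕ → ℕ} (hc : StrictMono c) {i n : ℕ} (h1 : c i ≤ n) (h2 : n < c (i + 1)) :
    blockIndex c n = i := by
  have h0 : c 0 ≤ n := (hc.monotone (Nat.zero_le i)).trans h1
  have h3 := hc.lt_iff_lt.1 ((blockIndex_le h0).trans_lt h2)
  have h4 := hc.lt_iff_lt.1 (h1.trans_lt (lt_blockIndex_succ hc n))
  omega

/-- Witnesses for a quantifier are chosen factor by factor and glued here into one infinite word. -/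
lemma exists_seg_eq {X : Type*} {c : ℕ → ℕ} (hc : IsCut c) (v : ℕ → List X)
    (hv : ∀ i, (v i).length = c (i + 1) - c i) :
    ∃ β : ℕ → X, ∀ i, seg β (c i) (c (i + 1)) = v i := by
  have key : ∀ n, n - c (blockIndex c n) < (v (blockIndex c n)).length := fun n => by
    have h1 := blockIndex_le (c := c) (n := n) (by simp [hc.zero])
    have h2 := lt_blockIndex_succ hc.strictMono n
    rw [hv]; omega
  refine ⟨fun n => (v (blockIndex c n))[n - c (blockIndex c n)]'(key n), fun i => ?_⟩
  refine List.ext_getElem (by simp [hv]) fun t h1 h2 => ?_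
  rw [seg_length] at h1
  have : blockIndex c (c i + t) = i := blockIndex_eq hc.strictMono (by omega) (by omega)
  simp [this]

lemma eq_of_seg_eq {X : Type*} {c : ℕ → ℕ} (hc : IsCut c) {α β : ℕ → X}
    (h : ∀ i, seg α (c i) (c (i + 1)) = seg β (c i) (c (i + 1))) : α = β := by
  funext n
  have h1 := blockIndex_le (c := c) (n := n) (by simp [hc.zero])
  have h2 := lt_blockIndex_succ hc.strictMono n
  set i := blockIndex c n
  have h3 := List.getElem_of_eq (h i) (i := n - c i) (by rw [seg_length]; omega)
  simpa [Nat.add_sub_cancel' h1] using h3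

lemma frequently_block_iff {c : ℕ → ℕ} (hc : IsCut c) (p : ℕ → Prop) :
    (∃ᶠ n in Filter.atTop, p n) ↔
      ∃ᶠ i in Filter.atTop, ∃ t, t < c (i + 1) - c i ∧ p (c i + t) := by
  simp only [Filter.frequently_atTop]
  constructor
  · intro h a
    obtain ⟨n, hn, hp⟩ := h (c a)
    have h1 := blockIndex_le (c := c) (n := n) (by simp [hc.zero])
    have h2 := lt_blockIndex_succ hc.strictMono n
    have h3 := hc.strictMono.lt_iff_lt.1 (hn.trans_lt h2)
    refine ⟨blockIndex c n, by omega, n - c (blockIndex c n), by omega, ?_⟩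
    rwa [Nat.add_sub_cancel' h1]
  · intro h a
    obtain ⟨i, hi, t, -, hp⟩ := h a
    exact ⟨c i + t, by have := hc.strictMono.id_le i; simp only [id] at this; omega, hp⟩

/-! ### Ramsey's theorem for pairs -/

/-- The infinite Ramsey theorem for pairs of natural numbers and finitely many colours. -/
theorem exists_strictMono_homogeneous {κ : Type*} [Finite κ] (col : ℕ → ℕ → κ) :
    ∃ (g : ℕ → ℕ) (k : κ), StrictMono g ∧ ∀ i j, i < j → col (g i) (g j) = k := by
  -- Along a non-principal ultrafilter every row `col n` has a limit colour, and these colours have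
  -- a limit `k`. Finitely many points with limit colour `k` can always be extended by a further
  -- one.
  let U : Ultrafilter ℕ := Filter.hyperfilter ℕ
  have hlim : ∀ q : ℕ → κ, ∃ k, ∀ᶠ n in (U : Filter ℕ), q n = k := by
    intro q
    exact Ultrafilter.eventually_exists_iff.1 (Filter.Eventually.of_forall fun n => ⟨q n, rfl⟩)
  choose lim hlim using hlim
  let K : ℕ → κ := fun n => lim (col n)
  let k := lim K
  have hstep : ∀ s : Finset ℕ, (∀ a ∈ s, K a = k) →
      ∃ m, K m = k ∧ ∀ a ∈ s, a < m ∧ col a m = k := by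
    intro s hs
    have h1 : ∀ᶠ m in (U : Filter ℕ), ∀ a ∈ s, a < m ∧ col a m = k := by
      rw [Filter.eventually_all_finset]
      intro a ha
      have h2 : ∀ᶠ m in (U : Filter ℕ), a < m := by
        refine Filter.hyperfilter_le_cofinite ?_
        rw [Nat.cofinite_eq_atTop]
        exact Filter.eventually_gt_atTop a
      have h3 := hlim (col a)
      filter_upwards [h2, h3] with m hm hm'
      exact ⟨hm, hm'.trans (hs a ha)⟩
    exact ((hlim K).and h1).exists
  obtain ⟨g, hg, hg'⟩ := exists_seq_of_forall_finset_exists (fun n => K n = k)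
    (fun a m => a < m ∧ col a m = k) hstep
  exact ⟨g, k, fun i j h => (hg' i j h).1, fun i j h => (hg' i j h).2⟩

/-! ### Recognition of sets of infinite words by finitely many types of finite words -/

/-- Membership in `L` depends only on the `h`-types of the factors in some factorisation. -/
def Recognizes {X T : Type*} (h : List X → T) (L : (ℕ → X) → Prop) : Prop :=
  ∀ c c' : ℕ → ℕ, IsCut c → IsCut c' → ∀ α β : ℕ → X,
    (∀ i, h (seg α (c i) (c (i + 1))) = h (seg β (c' i) (c' (i + 1)))) → L α → L β

/-! ### Splicing two words along a sequence of positions -/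

/-- The word `y` up to position `g 0`, and `e l` on the interval from `g l` to `g (l + 1)`. -/
def splice {X : Type*} (g : ℕ → ℕ) (y : ℕ → X) (e : ℕ → ℕ → X) : ℕ → X := fun n =>
  if n < g 0 then y n else e (blockIndex g n) n

lemma splice_of_lt {X : Type*} {g : ℕ → ℕ} {y : ℕ → X} {e : ℕ → ℕ → X} {n : ℕ} (h : n < g 0) :
    splice g y e n = y n := by
  simp [splice, h]

lemma splice_of_mem {X : Type*} {g : ℕ → ℕ} (hg : StrictMono g) {y : ℕ → X} {e : ℕ → ℕ → X}
    {l n : ℕ} (h1 : g l ≤ n) (h2 : n < g (l + 1)) : splice g y e n = e l n := by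
  have : ¬ n < g 0 := not_lt.2 ((hg.monotone (Nat.zero_le l)).trans h1)
  simp [splice, this, blockIndex_eq hg h1 h2]

/-- The factorisation whose first factor ends at `g 0`. -/
def consCut (g : ℕ → ℕ) : ℕ → ℕ
  | 0 => 0
  | i + 1 => g i

lemma isCut_consCut {g : ℕ → ℕ} (hg : StrictMono g) (h0 : 0 < g 0) : IsCut (consCut g) := by
  refine ⟨rfl, strictMono_nat_of_lt_succ fun n => ?_⟩
  cases n with
  | zero => exact h0
  | succ n => exact hg (Nat.lt_succ_self n)

/-- The convolution of two words. -/
def conv {X Y : Type*} (u : ℕ → X) (v : ℕ → Y) : ℕ → X × Y := fun n => (u n, v n)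

/-- Two words whose factors are those of `x` and `y` at the intervals in `G`, and otherwise
coincide with each other and with one of `x` and `y`. -/
structure Mixed {X : Type*} (x y : ℕ → X) (g : ℕ → ℕ) (G : Set ℕ) (u v : ℕ → X) : Prop where
  pre : ∀ n < g 0, u n = y n ∧ v n = y n
  mem : ∀ l ∈ G, ∀ n, g l ≤ n → n < g (l + 1) → u n = x n ∧ v n = y n
  notMem : ∀ l, l ∉ G → (∀ n, g l ≤ n → n < g (l + 1) → u n = x n ∧ v n = x n) ∨
    (∀ n, g l ≤ n → n < g (l + 1) → u n = y n ∧ v n = y n)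

lemma seg_conv_congr {X : Type*} {u v u' v' : ℕ → X} {a b : ℕ}
    (h : ∀ n, a ≤ n → n < b → u n = u' n ∧ v n = v' n) :
    seg (conv u v) a b = seg (conv u' v') a b :=
  seg_congr fun n h1 h2 => by simp [conv, h n h1 h2]

/-! ### Splices of two words at positions between which all types are constant. -/

section Homogeneous

variable {X T : Type*} {R : (ℕ → X) → (ℕ → X) → Prop} {h : List (X × X) → T}
  {x y : ℕ → X} {g : ℕ → ℕ} {a b p : T}

/-- Two words mixed along an infinite set without consecutive elements are related if and only if
some words with the alternating sequence of types `p b a b a …` are. -/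
lemma Mixed.exists_alternating
    (hR : Recognizes h fun w => R (fun n => (w n).1) (fun n => (w n).2))
    (hg : StrictMono g) (h0 : 0 < g 0)
    (hxx : ∀ i j, i < j → h (seg (conv x x) (g i) (g j)) = a)
    (hyy : ∀ i j, i < j → h (seg (conv y y) (g i) (g j)) = a)
    (hxy : ∀ i j, i < j → h (seg (conv x y) (g i) (g j)) = b)
    (hp : ∀ i, h (seg (conv y y) 0 (g i)) = p)
    {G : Set ℕ} (hG : G.Infinite) (hG' : ∀ l ∈ G, l + 1 ∉ G) {u v : ℕ → X}
    (huv : Mixed x y g G u v) :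
    ∃ (c : ℕ → ℕ) (u' v' : ℕ → X), IsCut c ∧ (R u v ↔ R u' v') ∧
      ∀ i, h (seg (conv u' v') (c i) (c (i + 1))) =
        if i = 0 then p else if i % 2 = 1 then b else a := by
  classical
  let e : ℕ → ℕ := Nat.nth (· ∈ G)
  have he : StrictMono e := Nat.nth_strictMono hG
  have heG : ∀ k, e k ∈ G := fun k => Nat.nth_mem_of_infinite hG k
  have heR : ∀ l ∈ G, ∃ k, e k = l := fun l hl => by
    have : l ∈ Set.range e := by
      rw [show Set.range e = _ from Nat.range_nth_of_infinite hG]; exact hl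
    exact this
  have hgap : ∀ k, e k + 1 < e (k + 1) := fun k => by
    have h1 := he (Nat.lt_succ_self k)
    have h2 : e (k + 1) ≠ e k + 1 := fun h => hG' _ (heG k) (h ▸ heG (k + 1))
    simp only [Nat.succ_eq_add_one] at h1
    omega
  have hlow : ∀ l, l < e 0 → l ∉ G := fun l hl hl' => by
    obtain ⟨k, rfl⟩ := heR l hl'
    exact absurd (he.lt_iff_lt.1 hl) (Nat.not_lt_zero k)
  have hbetween : ∀ k l, e k < l → l < e (k + 1) → l ∉ G := fun k l h1 h2 hl => by
    obtain ⟨j, rfl⟩ := heR l hl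
    have := he.lt_iff_lt.1 h1
    have := he.lt_iff_lt.1 h2
    omega
  -- The cuts after 0 are the two ends of the interval number `e 0`, then those of `e 1`, and so on.
  -- Elements of `G` are not consecutive, so the factors between these intervals are non-empty.
  let c : ℕ → ℕ := fun n => match n with
    | 0 => 0
    | m + 1 => g (e (m / 2) + m % 2)
  -- Normal form: outside `G` both words follow `y` before the first element of `G` and `x` after
  -- it. Single intervals of `(x, x)` and `(y, y)` have the same type `a`, so this replacement is
  -- invisible to `R`. Afterwards each gap of `G` is one long factor of `(x, x)`, which by
  -- homogeneity again has type `a`.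
  let u' := splice g y fun l => if l < e 0 then y else x
  let v' := splice g y fun l => if l < e 0 ∨ l ∈ G then y else x
  have hc : IsCut c := by
    refine ⟨rfl, strictMono_nat_of_lt_succ fun n => ?_⟩
    cases n with
    | zero => exact h0.trans_le (hg.monotone (Nat.zero_le _))
    | succ m =>
      refine hg ?_
      rcases Nat.even_or_odd' m with ⟨k, rfl | rfl⟩
      · have h1 : (2 * k + 1) / 2 = k := by omega
        have h2 : (2 * k) / 2 = k := by omega
        rw [h1, h2]; omega
      · have h1 : (2 * k + 1 + 1) / 2 = k + 1 := by omega
        have h2 : (2 * k + 1) / 2 = k := by omega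
        rw [h1, h2]; have := hgap k; omega
  have hloc : ∀ n, g 0 ≤ n → ∃ l, g l ≤ n ∧ n < g (l + 1) := fun n hn =>
    ⟨blockIndex g n, blockIndex_le hn, lt_blockIndex_succ hg n⟩
  refine ⟨c, u', v', hc, ?_, ?_⟩
  · have hcut := isCut_consCut hg h0
    have htypes : ∀ i, h (seg (conv u v) (consCut g i) (consCut g (i + 1))) =
        h (seg (conv u' v') (consCut g i) (consCut g (i + 1))) := by
      intro i
      cases i with
      | zero =>
        congr 1
        refine seg_conv_congr fun n _ hn => ?_
        change n < g 0 at hn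
        rw [(huv.pre n hn).1, (huv.pre n hn).2]
        exact ⟨(splice_of_lt hn).symm, (splice_of_lt hn).symm⟩
      | succ l =>
        change h (seg _ (g l) (g (l + 1))) = h (seg _ (g l) (g (l + 1)))
        have hu' : ∀ n, g l ≤ n → n < g (l + 1) → u' n = (if l < e 0 then y else x) n :=
          fun n h1 h2 => splice_of_mem hg h1 h2
        have hv' : ∀ n, g l ≤ n → n < g (l + 1) → v' n = (if l < e 0 ∨ l ∈ G then y else x) n :=
          fun n h1 h2 => splice_of_mem hg h1 h2
        have hll := Nat.lt_succ_self l
        by_cases hl : l ∈ G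
        · have hl0 : ¬ l < e 0 := fun hlt => hlow l hlt hl
          simp only [hl0, hl, or_true, if_true, if_false] at hu' hv'
          rw [seg_conv_congr (huv.mem l hl),
            seg_conv_congr (fun n h1 h2 => ⟨hu' n h1 h2, hv' n h1 h2⟩)]
        · have h1 : h (seg (conv u v) (g l) (g (l + 1))) = a := by
            rcases huv.notMem l hl with h1 | h1
            · rw [seg_conv_congr h1, hxx _ _ hll]
            · rw [seg_conv_congr h1, hyy _ _ hll]
          have h2 : h (seg (conv u' v') (g l) (g (l + 1))) = a := by
            by_cases hl0 : l < e 0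
            · simp only [hl0, true_or, if_true] at hu' hv'
              rw [seg_conv_congr (fun n h1 h2 => ⟨hu' n h1 h2, hv' n h1 h2⟩), hyy _ _ hll]
            · simp only [hl0, hl, or_false, if_false] at hu' hv'
              rw [seg_conv_congr (fun n h1 h2 => ⟨hu' n h1 h2, hv' n h1 h2⟩), hxx _ _ hll]
          rw [h1, h2]
    exact ⟨hR _ _ hcut hcut (conv u v) (conv u' v') htypes,
      hR _ _ hcut hcut (conv u' v') (conv u v) fun i => (htypes i).symm⟩
  · intro i
    cases i with
    | zero =>
      change h (seg _ 0 (g (e 0))) = p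
      rw [← hp (e 0)]
      congr 1
      refine seg_conv_congr fun n _ hn => ?_
      by_cases h1 : n < g 0
      · exact ⟨splice_of_lt h1, splice_of_lt h1⟩
      · obtain ⟨l, hl1, hl2⟩ := hloc n (not_lt.1 h1)
        have hl : l < e 0 := hg.lt_iff_lt.1 (hl1.trans_lt hn)
        constructor
        · change splice _ _ _ n = _
          rw [splice_of_mem hg hl1 hl2, if_pos hl]
        · change splice _ _ _ n = _
          rw [splice_of_mem hg hl1 hl2, if_pos (Or.inl hl)]
    | succ m =>
      change h (seg _ (g (e (m / 2) + m % 2)) (g (e ((m + 1) / 2) + (m + 1) % 2))) = _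
      rcases Nat.even_or_odd' m with ⟨k, rfl | rfl⟩
      · have h1 : (2 * k + 1) / 2 = k := by omega
        have h2 : (2 * k) / 2 = k := by omega
        have h3 : (2 * k + 1) % 2 = 1 := by omega
        have h4 : (2 * k) % 2 = 0 := by omega
        rw [h1, h2, h3, h4, add_zero, if_neg (by omega), if_pos rfl, ← hxy (e k) (e k + 1) (by omega)]
        congr 1
        refine seg_conv_congr fun n hn1 hn2 => ?_
        have hk : ¬ e k < e 0 := not_lt.2 (he.monotone (Nat.zero_le k))
        constructor
        · change splice _ _ _ n = _
          rw [splice_of_mem hg hn1 hn2, if_neg hk]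
        · change splice _ _ _ n = _
          rw [splice_of_mem hg hn1 hn2, if_pos (Or.inr (heG k))]
      · have h1 : (2 * k + 1 + 1) / 2 = k + 1 := by omega
        have h2 : (2 * k + 1) / 2 = k := by omega
        have h3 : (2 * k + 1 + 1) % 2 = 0 := by omega
        have h4 : (2 * k + 1) % 2 = 1 := by omega
        rw [h1, h2, h3, h4, if_neg (by omega), if_neg (by omega),
          ← hxx (e k + 1) (e (k + 1) + 0) (by have := hgap k; omega)]
        congr 1
        refine seg_conv_congr fun n hn1 hn2 => ?_
        obtain ⟨l, hl1, hl2⟩ := hloc n ((hg.monotone (Nat.zero_le _)).trans hn1)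
        have h5 := hg.lt_iff_lt.1 (hn1.trans_lt hl2)
        have h6 := hg.lt_iff_lt.1 (hl1.trans_lt hn2)
        have h7 : ¬ l < e 0 := by have := he.monotone (Nat.zero_le k); omega
        have h8 : l ∉ G := hbetween k l (by omega) (by omega)
        constructor
        · change splice _ _ _ n = _
          rw [splice_of_mem hg hl1 hl2, if_neg h7]
        · change splice _ _ _ n = _
          rw [splice_of_mem hg hl1 hl2, if_neg (by simp [h7, h8])]

/-- Both pairs reduce to the same sequence of types, although the cut positions differ; this is why
`Recognizes` allows two different factorisations. -/
lemma Mixed.rel_iff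
    (hR : Recognizes h fun w => R (fun n => (w n).1) (fun n => (w n).2))
    (hg : StrictMono g) (h0 : 0 < g 0)
    (hxx : ∀ i j, i < j → h (seg (conv x x) (g i) (g j)) = a)
    (hyy : ∀ i j, i < j → h (seg (conv y y) (g i) (g j)) = a)
    (hxy : ∀ i j, i < j → h (seg (conv x y) (g i) (g j)) = b)
    (hp : ∀ i, h (seg (conv y y) 0 (g i)) = p)
    {G₁ G₂ : Set ℕ} (hG₁ : G₁.Infinite) (hG₁' : ∀ l ∈ G₁, l + 1 ∉ G₁)
    (hG₂ : G₂.Infinite) (hG₂' : ∀ l ∈ G₂, l + 1 ∉ G₂) {u₁ v₁ u₂ v₂ : ℕ → X}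
    (h₁ : Mixed x y g G₁ u₁ v₁) (h₂ : Mixed x y g G₂ u₂ v₂) :
    R u₁ v₁ ↔ R u₂ v₂ := by
  obtain ⟨c, u, v, hc, huv, ht⟩ := h₁.exists_alternating hR hg h0 hxx hyy hxy hp hG₁ hG₁'
  obtain ⟨c', u', v', hc', huv', ht'⟩ := h₂.exists_alternating hR hg h0 hxx hyy hxy hp hG₂ hG₂'
  rw [huv, huv']
  exact ⟨hR c c' hc hc' (conv u v) (conv u' v') fun i => (ht i).trans (ht' i).symm,
    hR c' c hc' hc (conv u' v') (conv u v) fun i => (ht' i).trans (ht i).symm⟩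

open Classical in
/-- The splice of `x` and `y` which follows `y` on the intervals in `D`, and before `g 0`. -/
noncomputable def mix (x y : ℕ → X) (g : ℕ → ℕ) (D : Set ℕ) : ℕ → X :=
  splice g y fun l => if l ∈ D then y else x

lemma mix_of_lt {D : Set ℕ} {n : ℕ} (hn : n < g 0) : mix x y g D n = y n := splice_of_lt hn

lemma mix_of_mem (hg : StrictMono g) {D : Set ℕ} {l n : ℕ} (hl : l ∈ D) (h1 : g l ≤ n)
    (h2 : n < g (l + 1)) : mix x y g D n = y n := by
  rw [mix, splice_of_mem hg h1 h2, if_pos hl]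

lemma mix_of_notMem (hg : StrictMono g) {D : Set ℕ} {l n : ℕ} (hl : l ∉ D) (h1 : g l ≤ n)
    (h2 : n < g (l + 1)) : mix x y g D n = x n := by
  rw [mix, splice_of_mem hg h1 h2, if_neg hl]

lemma mixed_mix (hg : StrictMono g) {D E : Set ℕ} (hDE : D ⊆ E) :
    Mixed x y g (E \ D) (mix x y g D) (mix x y g E) where
  pre n hn := ⟨mix_of_lt hn, mix_of_lt hn⟩
  mem _ hl _ h1 h2 := ⟨mix_of_notMem hg hl.2 h1 h2, mix_of_mem hg hl.1 h1 h2⟩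
  notMem l hl := by
    by_cases hE : l ∈ E
    · have hD : l ∈ D := by by_contra hD; exact hl ⟨hE, hD⟩
      exact Or.inr fun _ h1 h2 => ⟨mix_of_mem hg hD h1 h2, mix_of_mem hg hE h1 h2⟩
    · exact Or.inl fun _ h1 h2 =>
        ⟨mix_of_notMem hg (fun hD => hE (hDE hD)) h1 h2, mix_of_notMem hg hE h1 h2⟩

lemma mix_univ (hg : StrictMono g) : mix x y g Set.univ = y := by
  funext n
  by_cases h : n < g 0
  · exact mix_of_lt h
  · exact mix_of_mem hg (Set.mem_univ _) (blockIndex_le (not_lt.1 h)) (lt_blockIndex_succ hg n)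

lemma mix_empty_of_le (hg : StrictMono g) {n : ℕ} (hn : g 0 ≤ n) : mix x y g ∅ n = x n :=
  mix_of_notMem hg (Set.notMem_empty _) (blockIndex_le hn) (lt_blockIndex_succ hg n)

lemma infinite_setOf_even : {n : ℕ | n % 2 = 0}.Infinite :=
  Set.infinite_of_injective_forall_mem (f := fun k : ℕ => 2 * k) (fun a b h => by simpa using h)
    fun k => by simp

lemma infinite_setOf_odd : {n : ℕ | n % 2 = 1}.Infinite :=
  Set.infinite_of_injective_forall_mem (f := fun k : ℕ => 2 * k + 1)
    (fun a b h => by simpa using h) fun k => by simp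

/-- Equivalence of one such pair would transfer to (∅, evens) and to (evens, ℕ), whose differences
are also infinite without consecutive elements. Transitivity then links the two extreme splices. -/
lemma not_rel_mix
    (hR : Recognizes h fun w => R (fun n => (w n).1) (fun n => (w n).2))
    (hg : StrictMono g) (h0 : 0 < g 0)
    (hxx : ∀ i j, i < j → h (seg (conv x x) (g i) (g j)) = a)
    (hyy : ∀ i j, i < j → h (seg (conv y y) (g i) (g j)) = a)
    (hxy : ∀ i j, i < j → h (seg (conv x y) (g i) (g j)) = b)
    (hp : ∀ i, h (seg (conv y y) 0 (g i)) = p)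
    (htrans : ∀ u v w, R u v → R v w → R u w) (hsep : ¬ R (mix x y g ∅) y)
    {D E : Set ℕ} (hDE : D ⊆ E) (hinf : (E \ D).Infinite) (hgap : ∀ l ∈ E \ D, l + 1 ∉ E \ D) :
    ¬ R (mix x y g D) (mix x y g E) := by
  intro hRDE
  let V : Set ℕ := {n | n % 2 = 0}
  have h1 : R (mix x y g ∅) (mix x y g V) := by
    refine (Mixed.rel_iff hR hg h0 hxx hyy hxy hp hinf hgap (G₂ := V \ ∅) ?_ ?_
      (mixed_mix hg hDE) (mixed_mix hg (Set.empty_subset _))).1 hRDE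
    · simpa using infinite_setOf_even
    · intro l hl hl'
      simp only [V, Set.sdiff_empty, Set.mem_ofPred_eq] at hl hl'
      omega
  have h2 : R (mix x y g V) (mix x y g Set.univ) := by
    refine (Mixed.rel_iff hR hg h0 hxx hyy hxy hp hinf hgap (G₂ := Set.univ \ V) ?_ ?_
      (mixed_mix hg hDE) (mixed_mix hg (Set.subset_univ _))).1 hRDE
    · convert infinite_setOf_odd using 1
      ext n
      simp [V]
    · intro l hl hl'
      simp only [V, Set.mem_sdiff, Set.mem_univ, true_and, Set.mem_ofPred_eq] at hl hl'
      omega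
  rw [mix_univ hg] at h2
  exact hsep (htrans _ _ _ h1 h2)

end Homogeneous

/-! ### A chain of continuum many sets of natural numbers with infinite differences -/

lemma exists_chain_infinite_diff : ∃ D : ℝ → Set ℕ, (∀ r s, r ≤ s → D r ⊆ D s) ∧
    (∀ r s, r < s → (D s \ D r).Infinite) ∧ ∀ r, ∀ l ∈ D r, l % 2 = 0 := by
  obtain ⟨q, hq⟩ := exists_surjective_nat ℚ
  -- Dedekind cuts: the number 2k stands for the rational `q k`. Odd numbers are left out so that
  -- differences contain no consecutive elements.
  refine ⟨fun r => {n | n % 2 = 0 ∧ ((q (n / 2) : ℚ) : ℝ) < r}, ?_, ?_, fun r l hl => hl.1⟩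
  · exact fun r s hrs n hn => ⟨hn.1, hn.2.trans_le hrs⟩
  · intro r s hrs hfin
    obtain ⟨q₁, hq₁, hq₁'⟩ := exists_rat_btwn hrs
    obtain ⟨q₂, hq₂, hq₂'⟩ := exists_rat_btwn hq₁'
    have hlt : q₁ < q₂ := by exact_mod_cast hq₂
    refine Set.Ioo_infinite hlt ((hfin.image fun n => q (n / 2)).subset fun t ht => ?_)
    obtain ⟨k, rfl⟩ := hq t
    have e : 2 * k / 2 = k := by omega
    have h1 : (q₁ : ℝ) < q k := by exact_mod_cast ht.1
    have h2 : ((q k : ℚ) : ℝ) < q₂ := by exact_mod_cast ht.2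
    refine ⟨2 * k, ⟨⟨by simp, ?_⟩, ?_⟩, by simp [e]⟩
    · rw [e]; linarith
    · rintro ⟨-, h3⟩
      rw [e] at h3; linarith

/-- If among the words of a recognisable set `S` there are more than `N₁ * N₂` that are pairwise
separated by a recognisable equivalence even after changes of finite prefixes, then `S` contains
continuum many pairwise inequivalent words. -/
theorem exists_continuum_pairwise_not_rel {X : Type} {N₁ N₂ M : ℕ} {S : Set (ℕ → X)}
    {R : (ℕ → X) → (ℕ → X) → Prop}
    (hrefl : ∀ u ∈ S, R u u) (hsymm : ∀ u v, R u v → R v u)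
    (htrans : ∀ u v w, R u v → R v w → R u w)
    (τ : (ℕ → X) → ℕ → ℕ → Fin N₁)
    (hτ : ∀ u v a b, (∀ n, a ≤ n → n < b → u n = v n) → τ u a b = τ v a b)
    (hS : ∀ u v c, IsCut c → (∀ i, τ u (c i) (c (i + 1)) = τ v (c i) (c (i + 1))) → u ∈ S → v ∈ S)
    (h : List (X × X) → Fin N₂)
    (hR : Recognizes h fun w => R (fun n => (w n).1) (fun n => (w n).2))
    (hM : N₁ * N₂ < M) (x : Fin M → ℕ → X) (hx : ∀ i, x i ∈ S)
    (hsep : ∀ i j, i < j → ∀ y, R (x j) y → ¬ ∀ᶠ n in Filter.atTop, y n = x i n) :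
    ∃ T ⊆ S, T.Pairwise (fun u v => ¬ R u v) ∧ #T = Cardinal.continuum := by
  let col : ℕ → ℕ → ((Fin M → Fin N₁) × (Fin M → Fin M → Fin N₂)) × (Fin M → Fin N₂) :=
    fun n m => ((fun i => τ (x i) n m, fun i j => h (seg (conv (x i) (x j)) n m)),
      fun i => h (seg (conv (x i) (x i)) 0 m))
  obtain ⟨g', k, hg', hk⟩ := exists_strictMono_homogeneous col
  -- Dropping the first position makes `g 0` positive. It also makes the types of the prefixes up to
  -- `g m` constant: the last component of `col` ignores its first argument, so it may be compared
  -- at `g' 0`.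
  let g : ℕ → ℕ := fun n => g' (n + 1)
  have hg : StrictMono g := fun i j hij => hg' (by omega)
  have h0 : 0 < g 0 := (Nat.zero_le _).trans_lt (hg' (show 0 < 0 + 1 by omega))
  have hcol : ∀ i j, i < j → col (g i) (g j) = k := fun i j hij => hk _ _ (by omega)
  have hpre : ∀ i m, h (seg (conv (x i) (x i)) 0 (g m)) = k.2 i := fun i m => by
    rw [← hk 0 (m + 1) (by omega)]
  have hpair : ∀ i j n m, n < m → h (seg (conv (x i) (x j)) (g n) (g m)) = k.1.2 i j :=
    fun i j n m hnm => by rw [← hcol n m hnm]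
  have htau : ∀ i n m, n < m → τ (x i) (g n) (g m) = k.1.1 i :=
    fun i n m hnm => by rw [← hcol n m hnm]
  -- Pigeonhole on the constant types: `N₁` for membership in `S`, `N₂` for the diagonal pairs.
  obtain ⟨i, j, hij, heq⟩ : ∃ i j, i < j ∧
      (k.1.1 i, k.1.2 i i) = (k.1.1 j, k.1.2 j j) := by
    obtain ⟨i, j, hne, heq⟩ := Fintype.exists_ne_map_eq_of_card_lt
      (fun i : Fin M => (k.1.1 i, k.1.2 i i)) (by simpa using hM)
    rcases lt_or_gt_of_ne hne with hlt | hlt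
    · exact ⟨i, j, hlt, heq⟩
    · exact ⟨j, i, hlt, heq.symm⟩
  rw [Prod.mk.injEq] at heq
  obtain ⟨D, hD, hDinf, hDeven⟩ := exists_chain_infinite_diff
  let W : ℝ → ℕ → X := fun r => mix (x i) (x j) g (D r)
  have hWS : ∀ r, W r ∈ S := by
    intro r
    refine hS (x j) (W r) (consCut g) (isCut_consCut hg h0) (fun l => ?_) (hx j)
    cases l with
    | zero => exact hτ _ _ _ _ fun n _ hn => (mix_of_lt hn).symm
    | succ l =>
      change τ _ (g l) (g (l + 1)) = τ _ (g l) (g (l + 1))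
      by_cases hl : l ∈ D r
      · exact hτ _ _ _ _ fun n h1 h2 => (mix_of_mem hg hl h1 h2).symm
      · rw [hτ (W r) (x i) _ _ fun n h1 h2 => mix_of_notMem hg hl h1 h2,
          htau _ _ _ (Nat.lt_succ_self l), htau _ _ _ (Nat.lt_succ_self l), heq.1]
  have hnot : ∀ r s, r < s → ¬ R (W r) (W s) := by
    intro r s hrs
    refine not_rel_mix hR hg h0 (hpair i i) (fun n m hnm => (hpair j j n m hnm).trans heq.2.symm)
      (hpair i j) (hpre j) htrans ?_ (hD r s hrs.le) (hDinf r s hrs) ?_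
    -- The splice along ∅ agrees with `x i` from `g 0` on, so it cannot be equivalent to the later
    -- word `x j`.
    · intro hcon
      refine hsep i j hij _ (hsymm _ _ hcon) ?_
      exact Filter.eventually_atTop.2 ⟨g 0, fun n hn => mix_empty_of_le hg hn⟩
    · intro l hl hl'
      have h1 := hDeven s l hl.1
      have h2 := hDeven s (l + 1) hl'.1
      omega
  have hne : ∀ r s, r ≠ s → ¬ R (W r) (W s) := by
    intro r s hrs
    rcases lt_or_gt_of_ne hrs with hlt | hlt
    · exact hnot r s hlt
    · exact fun hcon => hnot s r hlt (hsymm _ _ hcon)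
  have hinj : Function.Injective W := by
    intro r s hrs
    by_contra hcon
    exact hne r s hcon (hrs ▸ hrefl _ (hWS r))
  refine ⟨Set.range W, ?_, ?_, ?_⟩
  · rintro _ ⟨r, rfl⟩
    exact hWS r
  · rintro _ ⟨r, rfl⟩ _ ⟨s, rfl⟩ hrs
    exact hne r s fun h => hrs (h ▸ rfl)
  · rw [Cardinal.mk_range_eq W hinj, Cardinal.mk_real]

/-! ### Change of letters and renumbering of types. -/

lemma Recognizes.comap {X Y T : Type*} {h : List Y → T} {L : (ℕ → Y) → Prop}
    (hL : Recognizes h L) (r : X → Y) :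
    Recognizes (fun w => h (w.map r)) fun α => L fun n => r (α n) := by
  intro c c' hc hc' α β hαβ
  simp only [seg_map] at hαβ
  exact hL c c' hc hc' _ _ hαβ

lemma Recognizes.exists_fin {X T : Type*} [Fintype T] {h : List X → T} {L : (ℕ → X) → Prop}
    (hL : Recognizes h L) {N : ℕ} (hN : Fintype.card T ≤ N) :
    ∃ h' : List X → Fin N, Recognizes h' L := by
  obtain ⟨e⟩ := Function.Embedding.nonempty_of_card_le (α := T) (β := Fin N) (by simpa using hN)
  exact ⟨fun w => e (h w), fun c c' hc hc' α β hαβ =>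
    hL c c' hc hc' α β fun i => e.injective (hαβ i)⟩

/-! ### Omega-automata recognise by types of finite words -/

/-- `ρ` is a sequence of states which is a run on the finite word `u`. -/
def Automaton.IsRun {k m : ℕ} (B : Automaton k m) (u : List (Fin m → Fin k))
    (ρ : ℕ → Fin B.states) : Prop :=
  ∀ t (ht : t < u.length), (ρ t, u[t], ρ (t + 1)) ∈ B.trans

/-- The type of a finite word: the possible first states, last states and sets of visited states
of runs on it. -/
def Automaton.profile {k m : ℕ} (B : Automaton k m) (u : List (Fin m → Fin k)) :
    Set (Fin B.states × Fin B.states × Set (Fin B.states)) :=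
  {x | ∃ ρ, B.IsRun u ρ ∧ ρ 0 = x.1 ∧ ρ u.length = x.2.1 ∧ {q | ∃ t < u.length, ρ t = q} = x.2.2}

/-- An accepting run is cut into blocks, each block is replaced by a run on the other word's factor
with the same ends and the same visited states, and the new blocks are glued. Visited sets omit the
last state of a block, which belongs to the next one, and they determine the set of states visited
infinitely often, hence any of the three acceptance conditions. -/
lemma Automaton.recognizes_profile {k m : ℕ} (B : Automaton k m) :
    Recognizes B.profile fun α => B.Accepts fun j n => α n j := by
  rintro c c' hc hc' α β hαβ ⟨ρ, h0, htr, hacc⟩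
  have hmem : ∀ i, (ρ (c i), ρ (c (i + 1)), {q | ∃ t < c (i + 1) - c i, ρ (c i + t) = q}) ∈
      B.profile (seg β (c' i) (c' (i + 1))) := by
    intro i
    rw [← hαβ]
    have hlt := hc.strictMono (Nat.lt_succ_self i)
    simp only [Nat.succ_eq_add_one] at hlt
    refine ⟨fun t => ρ (c i + t), fun t ht => ?_, rfl, ?_, ?_⟩
    · rw [seg_getElem]
      exact htr (c i + t)
    · simp only [seg_length]
      congr 1
      omega
    · simp only [seg_length]
  choose σ hrun hfst hlast hvis using hmem
  simp only [seg_length] at hlast hvis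
  let ρ' : ℕ → Fin B.states := fun n => σ (blockIndex c' n) (n - c' (blockIndex c' n))
  have hρ' : ∀ i t, t < c' (i + 1) - c' i → ρ' (c' i + t) = σ i t := by
    intro i t ht
    have : blockIndex c' (c' i + t) = i := blockIndex_eq hc'.strictMono (by omega) (by omega)
    simp [ρ', this]
  have hpos : ∀ i, c' i < c' (i + 1) := fun i => hc'.strictMono (Nat.lt_succ_self i)
  have hρ'0 : ∀ i, ρ' (c' i) = ρ (c i) := fun i => by
    refine Eq.trans ?_ (hfst i)
    exact hρ' i 0 (by have := hpos i; omega)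
  refine ⟨ρ', ?_, fun n => ?_, ?_⟩
  · have := hρ'0 0
    rw [hc.zero, hc'.zero] at this
    rwa [this]
  · obtain ⟨i, h1, h2⟩ : ∃ i, c' i ≤ n ∧ n < c' (i + 1) :=
      ⟨blockIndex c' n, blockIndex_le (by simp [hc'.zero]), lt_blockIndex_succ hc'.strictMono n⟩
    obtain ⟨t, rfl⟩ := Nat.exists_eq_add_of_le h1
    have ht : t < c' (i + 1) - c' i := by omega
    have h3 := hrun i t (by simpa using ht)
    rw [seg_getElem] at h3
    rw [hρ' i t ht]
    have h4 : ρ' (c' i + t + 1) = σ i (t + 1) := by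
      rcases Nat.lt_or_ge (t + 1) (c' (i + 1) - c' i) with h | h
      · exact hρ' i (t + 1) h
      · have h5 : t + 1 = c' (i + 1) - c' i := by omega
        have h6 : c' i + t + 1 = c' (i + 1) := by omega
        rw [h6, hρ'0, h5, hlast]
    rw [h4]
    exact h3
  · convert hacc using 1
    ext q
    simp only [Set.mem_ofPred_eq]
    rw [frequently_block_iff hc' fun n => ρ' n = q, frequently_block_iff hc fun n => ρ n = q]
    have h1 : ∀ i, (∃ t < c' (i + 1) - c' i, ρ' (c' i + t) = q) ↔
        ∃ t < c (i + 1) - c i, ρ (c i + t) = q := by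
      intro i
      have h2 := Set.ext_iff.1 (hvis i) q
      simp only [Set.mem_ofPred_eq] at h2
      rw [← h2]
      exact exists_congr fun t => and_congr_right fun ht => by rw [hρ' i t ht]
    simp only [h1]

/-- A bound for the number of types of finite words needed for a formula whose code has length at
most `s`, if all automata have at most `M` states. -/
def typeBound (M : ℕ) : ℕ → ℕ
  | 0 => 2 ^ (M * M * 2 ^ M)
  | s + 1 => 2 ^ (typeBound M s * typeBound M s)

lemma le_two_pow_mul_self (n : ℕ) : n ≤ 2 ^ (n * n) :=
  Nat.lt_two_pow_self.le.trans (Nat.pow_le_pow_right two_pos (Nat.le_mul_self n))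

lemma typeBound_mono (M : ℕ) : Monotone (typeBound M) :=
  monotone_nat_of_le_succ fun s => le_two_pow_mul_self (typeBound M s)

lemma Automaton.exists_recognizes {k m : ℕ} (B : Automaton k m) {M : ℕ} (hM : B.states ≤ M)
    (s : ℕ) : ∃ h : List (Fin m → Fin k) → Fin (typeBound M s),
      Recognizes h fun α => B.Accepts fun j n => α n j := by
  classical
  -- A profile is a set of triples (state, state, set of states), which gives the value of
  -- `typeBound` at 0.
  refine B.recognizes_profile.exists_fin (le_trans ?_ (typeBound_mono M (Nat.zero_le s)))
  simp only [Fintype.card_set, Fintype.card_prod, Fintype.card_fin, typeBound, ← mul_assoc]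
  gcongr <;> norm_num

namespace Presentation

variable (P : Presentation)

/-- All automata of the presentation have at most `M` states. -/
structure StatesLE (M : ℕ) : Prop where
  dom : P.domAut.states ≤ M
  eqv : P.eqvAut.states ≤ M
  rel : ∀ i, (P.relAut i).states ≤ M

variable {P}

lemma exists_recognizes_dom {M : ℕ} (hM : P.StatesLE M) (s : ℕ) :
    ∃ h : List (Fin P.alphabet) → Fin (typeBound M s), Recognizes h (· ∈ P.dom) := by
  obtain ⟨h, hh⟩ := P.domAut.exists_recognizes hM.dom s
  refine ⟨fun w => h (w.map fun a _ => a), fun c c' hc hc' α β hαβ hα => ?_⟩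
  have key : ∀ α : Word P.alphabet, α ∈ P.dom ↔ P.domAut.Accepts fun _ n => α n := fun α => by
    change P.domAut.Accepts ![α] ↔ _
    rw [show (![α] : Fin 1 → Word P.alphabet) = fun _ n => α n from
      funext fun i => by fin_cases i; rfl]
  exact (key β).2 (hh.comap (fun a _ => a) c c' hc hc' α β hαβ ((key α).1 hα))

lemma exists_recognizes_approx {M : ℕ} (hM : P.StatesLE M) (s : ℕ) :
    ∃ h : List (Fin P.alphabet × Fin P.alphabet) → Fin (typeBound M s),
      Recognizes h fun w => P.Approx (fun n => (w n).1) (fun n => (w n).2) := by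
  obtain ⟨h, hh⟩ := P.eqvAut.exists_recognizes hM.eqv s
  refine ⟨fun w => h (w.map fun a => ![a.1, a.2]), fun c c' hc hc' α β hαβ hα => ?_⟩
  have key : ∀ α : ℕ → Fin P.alphabet × Fin P.alphabet,
      P.Approx (fun n => (α n).1) (fun n => (α n).2) ↔
        P.eqvAut.Accepts fun j n => ![(α n).1, (α n).2] j := fun α => by
    rw [Approx, show (![fun n => (α n).1, fun n => (α n).2] : Fin 2 → Word P.alphabet) =
      fun j n => ![(α n).1, (α n).2] j from funext fun i => by fin_cases i <;> rfl]
  exact (key β).2 (hh.comap (fun a => ![a.1, a.2]) c c' hc hc' α β hαβ ((key α).1 hα))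

/-! ### First-order formulas recognise by types of finite words -/

/-- The variable which is the given term. -/
def termVar {α : Type} : P.lang.Term α → α
  | .var a => a
  | .func g _ => nomatch g

lemma realize_eq_termVar {α : Type} {A : Type*} [P.lang.Structure A] (t : P.lang.Term α)
    (v : α → A) : t.realize v = v (termVar t) := by
  cases t with
  | var a => rfl
  | func g _ => exact nomatch g

/-- The convolution of the words named by the values of free and bound variables. -/
def valWord {k n : ℕ} (v : Fin k → P.dom) (xs : Fin n → P.dom) :
    ℕ → (Fin k ⊕ Fin n → Fin P.alphabet) := fun t i => (Sum.elim v xs i).1 t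

/-- On words in the domain, the truth of the formula `θ` depends only on the `h`-types of factors
in some factorisation. -/
def RecognizesFormula {A : Type*} [P.lang.Structure A] (f : P.dom → A) {k n : ℕ}
    (θ : P.lang.BoundedFormula (Fin k) n) {T : Type*}
    (h : List (Fin k ⊕ Fin n → Fin P.alphabet) → T) : Prop :=
  ∀ c c', IsCut c → IsCut c' → ∀ (v v' : Fin k → P.dom) (xs xs' : Fin n → P.dom),
    (∀ i, h (seg (valWord v xs) (c i) (c (i + 1))) =
      h (seg (valWord v' xs') (c' i) (c' (i + 1)))) →
    θ.Realize (fun i => f (v i)) (fun i => f (xs i)) →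
      θ.Realize (fun i => f (v' i)) (fun i => f (xs' i))

lemma RecognizesFormula.exists_fin {A : Type*} [P.lang.Structure A] {f : P.dom → A} {k n : ℕ}
    {θ : P.lang.BoundedFormula (Fin k) n} {T : Type*} [Fintype T]
    {h : List (Fin k ⊕ Fin n → Fin P.alphabet) → T} (hθ : RecognizesFormula f θ h) {N : ℕ}
    (hN : Fintype.card T ≤ N) :
    ∃ h' : List (Fin k ⊕ Fin n → Fin P.alphabet) → Fin N, RecognizesFormula f θ h' := by
  obtain ⟨e⟩ := Function.Embedding.nonempty_of_card_le (α := T) (β := Fin N) (by simpa using hN)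
  exact ⟨fun w => e (h w), fun c c' hc hc' v v' xs xs' hv =>
    hθ c c' hc hc' v v' xs xs' fun i => e.injective (hv i)⟩

/-- The letters of all but the last bound variable. -/
def dropLast {k n K : ℕ} (a : Fin k ⊕ Fin (n + 1) → Fin K) : Fin k ⊕ Fin n → Fin K :=
  fun i => a (Sum.map id Fin.castSucc i)

/-- The type of a factor is the set of types of its extensions by a track for the new variable. A
challenge `y'` on one side is answered factor by factor by a word `y` on the other side. The types
for the domain are carried along so that `y` names an element. -/
lemma recognizesFormula_all {A : Type*} [P.lang.Structure A] {f : P.dom → A}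
    (hf : Function.Surjective f) {k n : ℕ} {θ : P.lang.BoundedFormula (Fin k) (n + 1)}
    {T T' : Type*} {h : List (Fin k ⊕ Fin (n + 1) → Fin P.alphabet) → T}
    (hθ : RecognizesFormula f θ h) {hD : List (Fin P.alphabet) → T'}
    (hdom : Recognizes hD (· ∈ P.dom)) :
    RecognizesFormula f θ.all fun u =>
      {x : T × T' | ∃ w : List (Fin k ⊕ Fin (n + 1) → Fin P.alphabet), w.map dropLast = u ∧
        x = (h w, hD (w.map fun a => a (Sum.inr (Fin.last n))))} := by
  intro c c' hc hc' v v' xs xs' hv hall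
  rw [FirstOrder.Language.BoundedFormula.realize_all] at hall ⊢
  intro a
  obtain ⟨y', rfl⟩ := hf a
  have hsnoc : ∀ (xs : Fin n → P.dom) (y : P.dom),
      (Fin.snoc (fun i => f (xs i)) (f y) : Fin (n + 1) → A) =
        fun i => f ((Fin.snoc xs y : Fin (n + 1) → P.dom) i) := fun xs y =>
    (Fin.comp_snoc f xs y).symm
  have hdrop : ∀ (v : Fin k → P.dom) (xs : Fin n → P.dom) (y : P.dom),
      (fun t => dropLast (valWord v (Fin.snoc xs y : Fin (n + 1) → P.dom) t)) = valWord v xs := by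
    intro v xs y
    funext t i
    rcases i with i | i <;> simp [dropLast, valWord]
  have hlast : ∀ (v : Fin k → P.dom) (xs : Fin n → P.dom) (y : P.dom),
      (fun t => valWord v (Fin.snoc xs y : Fin (n + 1) → P.dom) t (Sum.inr (Fin.last n))) =
        y.1 := by
    intro v xs y
    funext t
    simp [valWord]
  have hmem : ∀ i, ∃ w : List (Fin k ⊕ Fin (n + 1) → Fin P.alphabet),
      w.map dropLast = seg (valWord v xs) (c i) (c (i + 1)) ∧
      (h (seg (valWord v' (Fin.snoc xs' y' : Fin (n + 1) → P.dom)) (c' i) (c' (i + 1))),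
        hD (seg y'.1 (c' i) (c' (i + 1)))) =
          (h w, hD (w.map fun a => a (Sum.inr (Fin.last n)))) := by
    intro i
    have h1 := Set.ext_iff.1 (hv i)
      (h (seg (valWord v' (Fin.snoc xs' y' : Fin (n + 1) → P.dom)) (c' i) (c' (i + 1))),
        hD (seg y'.1 (c' i) (c' (i + 1))))
    refine h1.2 ⟨seg (valWord v' (Fin.snoc xs' y' : Fin (n + 1) → P.dom)) (c' i) (c' (i + 1)),
      ?_, ?_⟩
    · rw [seg_map, hdrop]
    · rw [seg_map, hlast]
  choose w hw hw' using hmem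
  obtain ⟨ω, hω⟩ := exists_seg_eq hc w fun i => by
    rw [← List.length_map (f := dropLast), hw i, seg_length]
  have hωdrop : (fun t => dropLast (ω t)) = valWord v xs :=
    eq_of_seg_eq hc fun i => by rw [← hw i, ← hω i, seg_map]
  have hy : (fun t => ω t (Sum.inr (Fin.last n))) ∈ P.dom := by
    refine hdom c' c hc' hc y'.1 _ (fun i => ?_) y'.2
    rw [(Prod.mk.inj (hw' i)).2, ← hω i, seg_map]
  let y : P.dom := ⟨fun t => ω t (Sum.inr (Fin.last n)), hy⟩
  have hval : valWord v (Fin.snoc xs y : Fin (n + 1) → P.dom) = ω := by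
    funext t i
    rcases i with i | i
    · exact (congrFun (congrFun hωdrop t) (Sum.inl i)).symm
    · refine Fin.lastCases ?_ (fun i => ?_) i
      · simp [valWord, y]
      · have := (congrFun (congrFun hωdrop t) (Sum.inr i)).symm
        simpa [valWord, dropLast] using this
  have h2 := hall (f y)
  rw [hsnoc] at h2 ⊢
  refine hθ c c' hc hc' v v' _ _ (fun i => ?_) h2
  rw [hval, hω, (Prod.mk.inj (hw' i)).1]

/-- Since `RecognizesFormula` is symmetric in the two valuations, truth and falsity are both
preserved, and an implication needs only pairs of types. Each connective lengthens the code, which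
pays for one step of `typeBound`. -/
lemma exists_recognizesFormula {A : Type*} [P.lang.Structure A] {f : P.dom → A}
    (hPA : P.Presents A f) {M : ℕ} (hM : P.StatesLE M) {k n : ℕ}
    (θ : P.lang.BoundedFormula (Fin k) n) :
    ∃ h : List (Fin k ⊕ Fin n → Fin P.alphabet) → Fin (typeBound M (P.formulaCode θ).length),
      RecognizesFormula f θ h := by
  classical
  induction θ with
  | falsum =>
    refine RecognizesFormula.exists_fin (T := Unit) (h := fun _ => ()) ?_ ?_
    · intro c c' hc hc' v v' xs xs' hv hreal
      exact hreal
    · exact (Nat.one_le_two_pow (n := M * M * 2 ^ M)).trans (typeBound_mono M (Nat.zero_le _))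
  | equal s t =>
    obtain ⟨h, hh⟩ := exists_recognizes_approx hM (P.formulaCode (.equal s t)).length
    refine ⟨fun w => h (w.map fun a => (a (termVar s), a (termVar t))), ?_⟩
    intro c c' hc hc' v v' xs xs' hv hreal
    have key : ∀ (v : Fin k → P.dom) (xs : Fin _ → P.dom),
        (FirstOrder.Language.BoundedFormula.equal s t).Realize (fun i => f (v i))
          (fun i => f (xs i)) ↔
        P.Approx (fun n => valWord v xs n (termVar s)) (fun n => valWord v xs n (termVar t)) := by
      intro v xs
      change s.realize _ = t.realize _ ↔ _
      have hcomp : Sum.elim (fun i => f (v i)) (fun i => f (xs i)) =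
          fun i => f (Sum.elim v xs i) := by
        funext i; cases i <;> rfl
      rw [realize_eq_termVar, realize_eq_termVar, hPA.approx_iff, hcomp]
      exact ⟨fun h => ⟨(Sum.elim v xs (termVar s)).2, (Sum.elim v xs (termVar t)).2, h⟩,
        fun ⟨_, _, h⟩ => h⟩
    rw [key] at hreal ⊢
    exact hh.comap (fun a : Fin k ⊕ Fin _ → Fin P.alphabet => (a (termVar s), a (termVar t))) c c' hc hc' _ _ hv hreal
  | rel R ts =>
    obtain ⟨i, rfl⟩ := R
    obtain ⟨h, hh⟩ := (P.relAut i).exists_recognizes (hM.rel i)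
      (P.formulaCode (.rel (⟨i, rfl⟩ : P.lang.Relations _) ts)).length
    refine ⟨fun w => h (w.map fun a j => a (termVar (ts j))), ?_⟩
    intro c c' hc hc' v v' xs xs' hv hreal
    have key : ∀ (v : Fin k → P.dom) (xs : Fin _ → P.dom),
        (FirstOrder.Language.BoundedFormula.rel (⟨i, rfl⟩ : P.lang.Relations _) ts).Realize
          (fun i => f (v i)) (fun i => f (xs i)) ↔
        (P.relAut i).Accepts fun j n => valWord v xs n (termVar (ts j)) := by
      intro v xs
      have hcomp : Sum.elim (fun i => f (v i)) (fun i => f (xs i)) =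
          fun i => f (Sum.elim v xs i) := by
        funext i; cases i <;> rfl
      rw [hPA.rel_iff]
      change FirstOrder.Language.Structure.RelMap (L := P.lang) (⟨i, rfl⟩ : P.lang.Relations (P.arity i))
        (fun j => (ts j).realize (Sum.elim (fun i => f (v i)) (fun i => f (xs i)))) ↔ _
      simp only [realize_eq_termVar, hcomp]
      exact ⟨fun h => ⟨fun j => (Sum.elim v xs (termVar (ts j))).2, h⟩, fun ⟨_, h⟩ => h⟩
    rw [key] at hreal ⊢
    exact hh.comap (fun (a : Fin k ⊕ Fin _ → Fin P.alphabet) j => a (termVar (ts j))) c c' hc hc' _ _ hv hreal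
  | imp θ₁ θ₂ ih₁ ih₂ =>
    obtain ⟨h₁, hh₁⟩ := ih₁
    obtain ⟨h₂, hh₂⟩ := ih₂
    refine RecognizesFormula.exists_fin (h := fun w => (h₁ w, h₂ w)) ?_ ?_
    · intro c c' hc hc' v v' xs xs' hv hreal
      rw [FirstOrder.Language.BoundedFormula.realize_imp] at hreal ⊢
      intro h1
      refine hh₂ c c' hc hc' v v' xs xs' (fun i => (Prod.mk.inj (hv i)).2) (hreal ?_)
      exact hh₁ c' c hc' hc v' v xs' xs (fun i => (Prod.mk.inj (hv i)).1.symm) h1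
    · simp only [Fintype.card_prod, Fintype.card_fin, formulaCode, List.length_cons,
        List.length_append, typeBound]
      refine le_trans (Nat.mul_le_mul (typeBound_mono M (Nat.le_add_right _ _))
        (typeBound_mono M (Nat.le_add_left _ _))) Nat.lt_two_pow_self.le
  | all θ ih =>
    obtain ⟨h, hh⟩ := ih
    obtain ⟨hD, hhD⟩ := exists_recognizes_dom hM (P.formulaCode θ).length
    refine (recognizesFormula_all hPA.surjective hh hhD).exists_fin ?_
    simp [formulaCode, typeBound]

end Presentation

/-! ### The computable bound -/

lemma primrec_two_pow : Primrec fun n : ℕ => 2 ^ n := by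
  have : Primrec fun n : ℕ => Nat.rec (motive := fun _ => ℕ) 1 (fun _ y => 2 * y) n :=
    Primrec.nat_rec₁ 1 (Primrec.nat_mul.comp (Primrec.const 2) Primrec.snd)
  refine this.of_eq fun n => ?_
  induction n with
  | zero => rfl
  | succ n ih => rw [pow_succ', ← ih]

lemma primrec₂_typeBound : Primrec₂ typeBound := by
  have h0 : Primrec fun M : ℕ => 2 ^ (M * M * 2 ^ M) :=
    primrec_two_pow.comp
      (Primrec.nat_mul.comp (Primrec.nat_mul.comp Primrec.id Primrec.id) primrec_two_pow)
  have h1 : Primrec₂ fun (_ : ℕ) (p : ℕ × ℕ) => 2 ^ (p.2 * p.2) := by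
    have : Primrec fun q : ℕ × (ℕ × ℕ) => q.2.2 := Primrec.snd.comp Primrec.snd
    exact primrec_two_pow.comp (Primrec.nat_mul.comp this this)
  refine (Primrec.nat_rec h0 h1).of_eq fun M s => ?_
  induction s with
  | zero => rfl
  | succ s ih => simp only [typeBound, ← ih]

/-- The number of ends that suffice, as a function of the input. -/
def endsBound (d : PresentationData × ℕ × List ℕ) : ℕ :=
  typeBound (Encodable.encode d) (Encodable.encode d) *
    typeBound (Encodable.encode d) (Encodable.encode d) *
      typeBound (Encodable.encode d) (Encodable.encode d) + 1

/-- The code of the input serves as a crude bound for both the numbers of states and the length of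
the formula, so nothing has to be decoded. -/
lemma computable_endsBound : Computable endsBound := by
  have h : Primrec fun d : PresentationData × ℕ × List ℕ =>
      typeBound (Encodable.encode d) (Encodable.encode d) :=
    primrec₂_typeBound.comp Primrec.encode Primrec.encode
  exact (Primrec.succ.comp (Primrec.nat_mul.comp (Primrec.nat_mul.comp h h) h)).to_comp

/-! ### The code of an input bounds the sizes of its components. -/

lemma encode_fst_le {α β : Type*} [Encodable α] [Encodable β] (x : α × β) :
    Encodable.encode x.1 ≤ Encodable.encode x := by
  rw [Encodable.encode_prod_val x.1 x.2]
  exact Nat.left_le_pair _ _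

lemma encode_snd_le {α β : Type*} [Encodable α] [Encodable β] (x : α × β) :
    Encodable.encode x.2 ≤ Encodable.encode x := by
  rw [Encodable.encode_prod_val x.1 x.2]
  exact Nat.right_le_pair _ _

lemma encode_le_of_mem {α : Type*} [Encodable α] {a : α} {l : List α} (h : a ∈ l) :
    Encodable.encode a ≤ Encodable.encode l := by
  induction l with
  | nil => simp at h
  | cons b l ih =>
    rw [Encodable.encode_list_cons]
    rcases List.mem_cons.1 h with rfl | h
    · exact (Nat.left_le_pair _ _).trans (Nat.le_succ _)
    · exact (ih h).trans ((Nat.right_le_pair _ _).trans (Nat.le_succ _))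

lemma Automaton.states_le_encode_data {k m : ℕ} (B : Automaton k m) :
    B.states ≤ Encodable.encode B.data :=
  encode_fst_le B.data

namespace Presentation

variable {P : Presentation}

lemma statesLE_encode_data (P : Presentation) : P.StatesLE (Encodable.encode P.data) where
  dom := P.domAut.states_le_encode_data.trans
    ((encode_fst_le P.data.2).trans (encode_snd_le P.data))
  eqv := P.eqvAut.states_le_encode_data.trans
    ((encode_fst_le P.data.2.2).trans ((encode_snd_le P.data.2).trans (encode_snd_le P.data)))
  rel i := by
    have h1 : (P.arity i, (P.relAut i).data) ∈ P.data.2.2.2 := List.mem_ofFn.2 ⟨i, rfl⟩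
    exact (P.relAut i).states_le_encode_data.trans
      ((encode_snd_le (P.arity i, (P.relAut i).data)).trans ((encode_le_of_mem h1).trans
        ((encode_snd_le P.data.2.2).trans ((encode_snd_le P.data.2).trans (encode_snd_le P.data)))))

lemma StatesLE.mono {M N : ℕ} (h : P.StatesLE M) (hMN : M ≤ N) : P.StatesLE N :=
  ⟨h.dom.trans hMN, h.eqv.trans hMN, fun i => (h.rel i).trans hMN⟩

/-! ### Formulas about the structure on words -/

lemma realize_liftTerm {α : Type} (t : P.lang.Term α) (v : α → P.dom) :
    (P.liftTerm t).realize v = v (termVar t) := by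
  cases t with
  | var a => rfl
  | func g _ => exact nomatch g

/-- Equality becomes equivalence by `approx_iff`, and surjectivity of `f` turns quantifiers over `A`
into quantifiers over words. -/
lemma realize_lift {A : Type*} [P.lang.Structure A] {f : P.dom → A} (hPA : P.Presents A f)
    {α : Type} {n : ℕ} (θ : P.lang.BoundedFormula α n) (v : α → P.dom) (xs : Fin n → P.dom) :
    (P.lift θ).Realize v xs ↔ θ.Realize (fun i => f (v i)) (fun i => f (xs i)) := by
  have hcomp : ∀ {n : ℕ} (xs : Fin n → P.dom),
      Sum.elim (fun i => f (v i)) (fun i => f (xs i)) = fun i => f (Sum.elim v xs i) := by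
    intro n xs
    funext i
    cases i <;> rfl
  induction θ with
  | falsum => exact Iff.rfl
  | equal s t =>
    change P.Approx ((P.liftTerm s).realize (Sum.elim v xs)).1
      ((P.liftTerm t).realize (Sum.elim v xs)).1 ↔ s.realize _ = t.realize _
    rw [realize_liftTerm, realize_liftTerm, realize_eq_termVar, realize_eq_termVar,
      hPA.approx_iff, hcomp]
    exact ⟨fun ⟨_, _, h⟩ => h,
      fun h => ⟨(Sum.elim v xs (termVar s)).2, (Sum.elim v xs (termVar t)).2, h⟩⟩
  | rel R ts =>
    obtain ⟨i, rfl⟩ := R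
    change (P.relAut i).Accepts (fun j => ((P.liftTerm (ts j)).realize (Sum.elim v xs)).1) ↔
      FirstOrder.Language.Structure.RelMap (L := P.lang) (⟨i, rfl⟩ : P.lang.Relations (P.arity i))
        (fun j => (ts j).realize (Sum.elim (fun i => f (v i)) (fun i => f (xs i))))
    rw [hPA.rel_iff]
    simp only [realize_liftTerm, realize_eq_termVar, hcomp]
    exact ⟨fun ⟨_, h⟩ => h, fun h => ⟨fun j => (Sum.elim v xs (termVar (ts j))).2, h⟩⟩
  | imp θ₁ θ₂ ih₁ ih₂ =>
    change ((P.lift θ₁).Realize v xs → (P.lift θ₂).Realize v xs) ↔ (_ → _)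
    exact imp_congr (ih₁ xs) (ih₂ xs)
  | all θ ih =>
    change (∀ y : P.dom, (P.lift θ).Realize v (Fin.snoc xs y)) ↔ ∀ a : A, _
    rw [hPA.surjective.forall]
    refine forall_congr' fun y => ?_
    refine (ih _).trans ?_
    have : (fun i => f ((Fin.snoc xs y : Fin _ → P.dom) i)) =
        (Fin.snoc (fun i => f (xs i)) (f y) : Fin _ → A) := Fin.comp_snoc f xs y
    rw [this]

lemma realize_liftAt {A : Type*} [P.lang.Structure A] {f : P.dom → A} (hPA : P.Presents A f)
    {m : ℕ} {β : Type} (φ : P.lang.Formula (Fin (m + 1))) (t : β) (z : Fin m → β) (v : β → P.dom) :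
    (P.liftAt φ t z).Realize v ↔ (v t).1 ∈ P.solutions f φ fun i => (v (z i)).1 := by
  rw [liftAt, FirstOrder.Language.Formula.realize_relabel]
  have h := realize_lift hPA φ (v ∘ (Fin.cons t z : Fin (m + 1) → β)) default
  have hv : (fun i => f ((v ∘ (Fin.cons t z : Fin (m + 1) → β)) i)) =
      (Fin.cons (f (v t)) (fun i => f (v (z i))) : Fin (m + 1) → A) := by
    funext i
    refine Fin.cases ?_ (fun i => ?_) i <;> simp
  rw [hv, Subsingleton.elim (fun i : Fin 0 => f ((default : Fin 0 → P.dom) i)) default] at h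
  exact h.trans ⟨fun h => ⟨(v t).2, fun i => (v (z i)).2, h⟩, fun ⟨_, _, h⟩ => h⟩

lemma realize_atom_approx {β : Type} (s t : β) (v : β → P.dom) :
    (P.atom .approx s t).Realize v ↔ P.Approx (v s).1 (v t).1 :=
  FirstOrder.Language.Formula.realize_rel₂ (L := P.endsLang)
    (R := (Sum.inr .approx : P.endsLang.Relations 2))

lemma realize_atom_eqEnds {β : Type} (s t : β) (v : β → P.dom) :
    (P.atom .eqEnds s t).Realize v ↔ EqualEnds (v s).1 (v t).1 :=
  FirstOrder.Language.Formula.realize_rel₂ (L := P.endsLang)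
    (R := (Sum.inr .eqEnds : P.endsLang.Relations 2))

lemma realize_coverFormula {A : Type*} [P.lang.Structure A] {f : P.dom → A}
    (hPA : P.Presents A f) {m : ℕ} (φ : P.lang.Formula (Fin (m + 1))) (C : ℕ) (z : Fin m → P.dom) :
    (P.coverFormula φ C).Realize z ↔
      P.CoveredByEnds (P.solutions f φ fun i => (z i).1) C := by
  have h1 : (P.coverFormula φ C).Realize z ↔ ∃ x : Fin C → P.dom,
      (∀ i, (x i).1 ∈ P.solutions f φ fun i => (z i).1) ∧
      ∀ u : Unit → P.dom, (u ()).1 ∈ P.solutions f φ (fun i => (z i).1) →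
        ∃ y : Unit → P.dom, P.Approx (u ()).1 (y ()).1 ∧
          ∃ i, EqualEnds (y ()).1 (x i).1 := by
    rw [coverFormula, FirstOrder.Language.Formula.realize_iExs]
    refine exists_congr fun x => ?_
    rw [FirstOrder.Language.Formula.realize_inf]
    refine and_congr ?_ ?_
    · refine FirstOrder.Language.BoundedFormula.realize_iInf.trans (forall_congr' fun i => ?_)
      exact realize_liftAt hPA _ _ _ _
    · rw [FirstOrder.Language.Formula.realize_iAlls]
      refine forall_congr' fun u => ?_
      rw [FirstOrder.Language.Formula.realize_imp]
      refine imp_congr (realize_liftAt hPA _ _ _ _) ?_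
      rw [FirstOrder.Language.Formula.realize_iExs]
      refine exists_congr fun y => ?_
      rw [FirstOrder.Language.Formula.realize_inf]
      refine and_congr (realize_atom_approx _ _ _) ?_
      refine FirstOrder.Language.BoundedFormula.realize_iSup.trans (exists_congr fun i => ?_)
      exact realize_atom_eqEnds _ _ _
  rw [h1]
  constructor
  · rintro ⟨x, hx, hu⟩
    refine ⟨fun i => (x i).1, hx, fun u huS => ?_⟩
    obtain ⟨y, hy, i, hi⟩ := hu (fun _ => ⟨u, huS.1⟩) huS
    exact ⟨_, hy, i, hi⟩
  · rintro ⟨x, hx, hu⟩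
    refine ⟨fun i => ⟨x i, (hx i).1⟩, hx, fun u huS => ?_⟩
    obtain ⟨y, hy, i, hi⟩ := hu _ huS
    -- A word equivalent to some word lies in the domain, so it does not matter whether `y` ranges
    -- over all words or over `P.dom`.
    obtain ⟨_, hyd, _⟩ := (hPA.approx_iff _ _).1 hy
    exact ⟨fun _ => ⟨y, hyd⟩, hy, i, hi⟩

lemma realize_countableFormula {A : Type*} [P.lang.Structure A] {f : P.dom → A}
    (hPA : P.Presents A f) {m : ℕ} (φ : P.lang.Formula (Fin (m + 1))) (C : ℕ) (z : Fin m → P.dom) :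
    (P.countableFormula φ C).Realize z ↔
      ((P.solutions f φ fun i => (z i).1).Nonempty →
        P.CoveredByEnds (P.solutions f φ fun i => (z i).1) C) := by
  rw [countableFormula, FirstOrder.Language.Formula.realize_imp, realize_coverFormula hPA,
    FirstOrder.Language.Formula.realize_iExs]
  have key : ∀ w : Unit → P.dom,
      (P.liftAt φ (Sum.inr () : Fin m ⊕ Unit) Sum.inl).Realize (Sum.elim z w) ↔
        (w ()).1 ∈ P.solutions f φ fun i => (z i).1 := fun w => realize_liftAt hPA _ _ _ _
  simp only [key]
  exact imp_congr_left ⟨fun ⟨w, hw⟩ => ⟨_, hw⟩, fun ⟨w, hw⟩ => ⟨fun _ => ⟨w, hw.1⟩, hw⟩⟩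

/-! ### Countably many classes -/

lemma countable_setOf_equalEnds {k : ℕ} (x : Word k) : {y : Word k | EqualEnds y x}.Countable := by
  have h : {y : Word k | EqualEnds y x} ⊆ ⋃ a : ℕ, Set.range fun (s : Fin a → Fin k) (n : ℕ) =>
      if h : n < a then s ⟨n, h⟩ else x n := by
    intro y hy
    obtain ⟨a, ha⟩ := Filter.eventually_atTop.1 hy
    refine Set.mem_iUnion.2 ⟨a, fun i => y i, funext fun n => ?_⟩
    by_cases hn : n < a
    · simp [hn]
    · simp [hn, ha n (not_lt.1 hn)]
  exact (Set.countable_iUnion fun a => Set.countable_range _).mono h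

lemma CoveredByEnds.countable_classes {S : Set (Word P.alphabet)} {C : ℕ}
    (hS : P.CoveredByEnds S C) (hsymm : ∀ u v, P.Approx u v → P.Approx v u)
    (htrans : ∀ u v w, P.Approx u v → P.Approx v w → P.Approx u w) :
    (P.classes S).Countable := by
  obtain ⟨x, -, hx⟩ := hS
  have h1 : (⋃ i, {y | EqualEnds y (x i)}).Countable :=
    Set.countable_iUnion fun i => countable_setOf_equalEnds _
  refine (h1.image fun y => {v ∈ S | P.Approx y v}).mono ?_
  rintro _ ⟨u, hu, rfl⟩
  obtain ⟨y, huy, i, hi⟩ := hx u hu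
  refine ⟨y, Set.mem_iUnion.2 ⟨i, hi⟩, Set.ext fun v => and_congr_right fun _ => ?_⟩
  exact ⟨htrans _ _ _ huy, htrans _ _ _ (hsymm _ _ huy)⟩

lemma not_countable_classes {S T : Set (Word P.alphabet)} (hTS : T ⊆ S)
    (hrefl : ∀ u ∈ S, P.Approx u u) (hT : T.Pairwise fun u v => ¬ P.Approx u v)
    (hcard : #T = Cardinal.continuum) : ¬ (P.classes S).Countable := by
  intro hcount
  have hmaps : Set.MapsTo (fun u => {v ∈ S | P.Approx u v}) T (P.classes S) :=
    fun u hu => ⟨u, hTS hu, rfl⟩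
  have hinj : Set.InjOn (fun u => {v ∈ S | P.Approx u v}) T := by
    intro u hu v hv huv
    by_contra hne
    refine hT hu hv hne ?_
    have : v ∈ {w ∈ S | P.Approx v w} := ⟨hTS hv, hrefl v (hTS hv)⟩
    rw [← show {w ∈ S | P.Approx u w} = {w ∈ S | P.Approx v w} from huv] at this
    exact this.2
  have h1 : T.Countable := hmaps.countable_of_injOn hinj hcount
  have h2 := Cardinal.le_aleph0_iff_set_countable.2 h1
  rw [hcard] at h2
  exact absurd h2 (not_le.2 Cardinal.aleph0_lt_continuum)

/-- Greedy choice: as long as at most `C` words have been chosen, they do not cover `S`, and an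
uncovered word can be added. Separation is only from earlier to later words, which is all that is
needed. -/
lemma exists_separated {S : Set (Word P.alphabet)} (hne : S.Nonempty) {C : ℕ}
    (hS : ¬ P.CoveredByEnds S C) : ∀ k ≤ C, ∃ x : Fin k → Word P.alphabet, (∀ i, x i ∈ S) ∧
      ∀ i j, i < j → ∀ y, P.Approx (x j) y → ¬ EqualEnds y (x i) := by
  intro k
  induction k with
  | zero => exact fun _ => ⟨Fin.elim0, fun i => i.elim0, fun i => i.elim0⟩
  | succ k ih =>
    intro hk
    obtain ⟨x, hx, hsep⟩ := ih (by omega)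
    obtain ⟨s, hs⟩ := hne
    have h1 : ∃ u ∈ S, ∀ y, P.Approx u y → ∀ i, ¬ EqualEnds y (x i) := by
      by_contra! hcon
      -- The words chosen so far are padded to `C` words by an arbitrary element of `S`.
      refine hS ⟨fun i => if h : i.1 < k then x ⟨i, h⟩ else s, fun i => ?_, fun u hu => ?_⟩
      · by_cases h : i.1 < k
        · simp [h, hx]
        · simp [h, hs]
      · obtain ⟨y, hy, i, hi⟩ := hcon u hu
        refine ⟨y, hy, ⟨i, by omega⟩, ?_⟩
        simpa using hi
    obtain ⟨u, hu, hsepu⟩ := h1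
    refine ⟨Fin.snoc x u, fun i => ?_, fun i j hij => ?_⟩
    · refine Fin.lastCases ?_ (fun i => ?_) i <;> simp [hu, hx]
    · induction j using Fin.lastCases with
      | last =>
        induction i using Fin.lastCases with
        | last => exact absurd hij (lt_irrefl _)
        | cast i => simpa using fun y hy => hsepu y hy i
      | cast j =>
        induction i using Fin.lastCases with
        | last => exact absurd hij (not_lt.2 (Fin.castSucc_lt_last j).le)
        | cast i => simpa using hsep i j (by simpa using hij)

/-- If `φ(-, z)` is not covered by the ends of sufficiently many of its words, then it contains
continuum many pairwise inequivalent words. -/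
theorem exists_continuum_of_not_coveredByEnds {A : Type*} [P.lang.Structure A] {f : P.dom → A}
    (hPA : P.Presents A f) {M : ℕ} (hM : P.StatesLE M) {m : ℕ}
    (φ : P.lang.Formula (Fin (m + 1))) (hφ : (P.formulaCode φ).length ≤ M)
    (z : Fin m → Word P.alphabet) (hne : (P.solutions f φ z).Nonempty)
    (hcov : ¬ P.CoveredByEnds (P.solutions f φ z)
      (typeBound M M * typeBound M M * typeBound M M + 1)) :
    ∃ T ⊆ P.solutions f φ z,
      T.Pairwise (fun u v => ¬ P.Approx u v) ∧ #T = Cardinal.continuum := by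
  classical
  obtain ⟨x, hx, hsep⟩ := exists_separated hne hcov _ le_rfl
  obtain ⟨_, hz, _⟩ := hne.some_mem
  obtain ⟨h₀, hh₀⟩ := exists_recognizesFormula hPA hM φ
  obtain ⟨h, hh⟩ := hh₀.exists_fin (N := typeBound M M) (by simpa using typeBound_mono M hφ)
  obtain ⟨hD, hhD⟩ := exists_recognizes_dom hM M
  obtain ⟨hE, hhE⟩ := exists_recognizes_approx hM M
  let W : Word P.alphabet → ℕ → (Fin (m + 1) ⊕ Fin 0 → Fin P.alphabet) := fun u n =>
    Sum.elim (Fin.cons (u n) fun i => z i n) fun i => i.elim0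
  have hW : ∀ (u : Word P.alphabet) (hu : u ∈ P.dom), W u =
      valWord (Fin.cons ⟨u, hu⟩ (fun i => ⟨z i, hz i⟩) : Fin (m + 1) → P.dom) default := by
    intro u hu
    funext n i
    rcases i with i | i
    · refine Fin.cases ?_ (fun i => ?_) i <;> simp [W, valWord]
    · exact i.elim0
  have hsol : ∀ (u : Word P.alphabet) (hu : u ∈ P.dom), u ∈ P.solutions f φ z ↔
      FirstOrder.Language.BoundedFormula.Realize φ
        (fun i => f ((Fin.cons ⟨u, hu⟩ (fun i => ⟨z i, hz i⟩) : Fin (m + 1) → P.dom) i))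
        (fun i => f ((default : Fin 0 → P.dom) i)) := by
    intro u hu
    have hv : (fun i => f ((Fin.cons ⟨u, hu⟩ (fun i => ⟨z i, hz i⟩) : Fin (m + 1) → P.dom) i)) =
        (Fin.cons (f ⟨u, hu⟩) (fun i => f ⟨z i, hz i⟩) : Fin (m + 1) → A) := by
      funext i
      refine Fin.cases ?_ (fun i => ?_) i <;> simp
    rw [hv, Subsingleton.elim (fun i : Fin 0 => f ((default : Fin 0 → P.dom) i)) default]
    exact ⟨fun ⟨_, _, h⟩ => h, fun h => ⟨hu, hz, h⟩⟩
  -- The type also reads the fixed parameters `z` on the interval, so it depends on the positions;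
  -- hence solutions are compared along one common factorisation. The second component ensures that
  -- a splice lies in the domain.
  let τ : Word P.alphabet → ℕ → ℕ → Fin (typeBound M M * typeBound M M) := fun u a b =>
    finProdFinEquiv (h (seg (W u) a b), hD (seg u a b))
  refine exists_continuum_pairwise_not_rel (S := P.solutions f φ z) (R := P.Approx)
    (fun u hu => (hPA.approx_iff u u).2 ⟨hu.1, hu.1, rfl⟩) ?_ ?_ τ ?_ ?_ hE hhE
    (Nat.lt_succ_self _) x hx hsep
  · intro u v huv
    obtain ⟨hu, hv, h⟩ := (hPA.approx_iff u v).1 huv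
    exact (hPA.approx_iff v u).2 ⟨hv, hu, h.symm⟩
  · intro u v w huv hvw
    obtain ⟨hu, hv, h⟩ := (hPA.approx_iff u v).1 huv
    obtain ⟨_, hw, h'⟩ := (hPA.approx_iff v w).1 hvw
    exact (hPA.approx_iff u w).2 ⟨hu, hw, h.trans h'⟩
  · intro u v a b huv
    have h1 : seg (W u) a b = seg (W v) a b := seg_congr fun n ha hb => by
      simp only [W, huv n ha hb]
    simp only [τ, h1, seg_congr huv]
  · intro u v c hc huv hu
    have h1 : ∀ i, h (seg (W u) (c i) (c (i + 1))) = h (seg (W v) (c i) (c (i + 1))) ∧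
        hD (seg u (c i) (c (i + 1))) = hD (seg v (c i) (c (i + 1))) := fun i =>
      Prod.mk.inj (finProdFinEquiv.injective (huv i))
    have hv : v ∈ P.dom := hhD c c hc hc u v (fun i => (h1 i).2) hu.1
    rw [hsol v hv]
    refine hh c c hc hc _ _ _ _ (fun i => ?_) ((hsol u hu.1).1 hu)
    rw [← hW, ← hW]
    exact (h1 i).1

end Presentation

end OmegaAut

/-! ### The theorem. -/

theorem proposition3 :
    ∃ F : OmegaAut.PresentationData × ℕ × List ℕ → ℕ, Computable F ∧
      ∀ (P : OmegaAut.Presentation) (m : ℕ) (φ : P.lang.Formula (Fin (m + 1))) (C : ℕ),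
        C = F (P.data, m, P.formulaCode φ) →
        ∀ (A : Type*) [P.lang.Structure A] (f : P.dom → A), P.Presents A f →
          -- the characterisation, for all tuples of infinite words
          (∀ z : Fin m → OmegaAut.Word P.alphabet,
            ((P.solutions f φ z).Nonempty ∧ (P.classes (P.solutions f φ z)).Countable ↔
              P.CoveredByEnds (P.solutions f φ z) C) ∧
            -- if it fails for a non-empty set, there are continuum many classes
            ((P.solutions f φ z).Nonempty → ¬ P.CoveredByEnds (P.solutions f φ z) C →
              ∃ T ⊆ P.solutions f φ z,
                T.Pairwise (fun u v => ¬ P.Approx u v) ∧ #T = Cardinal.continuum)) ∧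
          -- first-order definability in the structure on words, expanded by equal ends
          (∀ z : Fin m → P.dom,
            ((P.coverFormula φ C).Realize z ↔
              (P.solutions f φ (fun i => (z i).1)).Nonempty ∧
                (P.classes (P.solutions f φ (fun i => (z i).1))).Countable) ∧
            ((P.countableFormula φ C).Realize z ↔
              (P.classes (P.solutions f φ (fun i => (z i).1))).Countable)) := by
  refine ⟨OmegaAut.endsBound, OmegaAut.computable_endsBound, ?_⟩
  rintro P m φ C rfl A _ f hPA
  set d : OmegaAut.PresentationData × ℕ × List ℕ := (P.data, m, P.formulaCode φ) with hd
  have hM : P.StatesLE (Encodable.encode d) :=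
    P.statesLE_encode_data.mono (OmegaAut.encode_fst_le d)
  have hφ : (P.formulaCode φ).length ≤ Encodable.encode d :=
    (Encodable.length_le_encode _).trans
      ((OmegaAut.encode_snd_le d.2).trans (OmegaAut.encode_snd_le d))
  have hrefl : ∀ z, ∀ u ∈ P.solutions f φ z, P.Approx u u := fun z u hu =>
    (hPA.approx_iff u u).2 ⟨hu.1, hu.1, rfl⟩
  have hsymm : ∀ u v, P.Approx u v → P.Approx v u := fun u v huv => by
    obtain ⟨hu, hv, h⟩ := (hPA.approx_iff u v).1 huv
    exact (hPA.approx_iff v u).2 ⟨hv, hu, h.symm⟩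
  have htrans : ∀ u v w, P.Approx u v → P.Approx v w → P.Approx u w := fun u v w huv hvw => by
    obtain ⟨hu, hv, h⟩ := (hPA.approx_iff u v).1 huv
    obtain ⟨_, hw, h'⟩ := (hPA.approx_iff v w).1 hvw
    exact (hPA.approx_iff u w).2 ⟨hu, hw, h.trans h'⟩
  have hcont : ∀ z, (P.solutions f φ z).Nonempty →
      ¬ P.CoveredByEnds (P.solutions f φ z) (OmegaAut.endsBound d) →
      ∃ T ⊆ P.solutions f φ z,
        T.Pairwise (fun u v => ¬ P.Approx u v) ∧ #T = Cardinal.continuum :=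
    fun z hne hcov =>
      OmegaAut.Presentation.exists_continuum_of_not_coveredByEnds hPA hM φ hφ z hne hcov
  have hiff : ∀ z, (P.solutions f φ z).Nonempty ∧ (P.classes (P.solutions f φ z)).Countable ↔
      P.CoveredByEnds (P.solutions f φ z) (OmegaAut.endsBound d) := by
    intro z
    constructor
    · rintro ⟨hne, hcount⟩
      by_contra hcov
      obtain ⟨T, hTS, hT, hcard⟩ := hcont z hne hcov
      exact OmegaAut.Presentation.not_countable_classes hTS (hrefl z) hT hcard hcount
    · intro hcov
      refine ⟨?_, hcov.countable_classes hsymm htrans⟩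
      obtain ⟨x, hx, -⟩ := hcov
      -- The bound is a successor, so a cover contains at least one word.
      exact ⟨_, hx ⟨0, Nat.succ_pos _⟩⟩
  refine ⟨fun z => ⟨hiff z, hcont z⟩, fun z => ⟨?_, ?_⟩⟩
  · rw [OmegaAut.Presentation.realize_coverFormula hPA, hiff]
  · rw [OmegaAut.Presentation.realize_countableFormula hPA, ← hiff]
    constructor
    · intro h
      rcases Set.eq_empty_or_nonempty (P.solutions f φ fun i => (z i).1) with he | hne
      · rw [he]
        convert Set.countable_empty
        ext E
        simp [OmegaAut.Presentation.classes]
      · exact (h hne).2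
    · exact fun h hne => ⟨hne, h⟩
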